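/- **Theorem (Classification Theorem for P4).** Let $W(x,y)$ be a real polynomial of degree $N\ge 2$, with $W_N$ its homogeneous part of degree $N$. Assume that $W(x,y)>0$ for all $(x,y)\in\mathbb R^2$ and that $W_N$ is positive definite, i.e. $W_N(x,y)>0$ for $(x,y)\neq(0,0)$. Consider the system $$\frac{dx}{dt}=x(x^2+y^2-1)(x^2+y^2-9)-y(x^2+y^2-2x-8)\,W(x,y),$$ $$\frac{dy}{dt}=y(x^2+y^2-1)(x^2+y^2-9)+x(x^2+y^2-2x-8)\,W(x,y).$$ Its phase portrait has the features that Poincaré listed for his fourth example (the case $W=1$ of these equations): 1. The fixed points in the plane are exactly $O=(0,0)$, $A=(\tfrac12,\tfrac{\sqrt{35}}2)$ and $B=(\tfrac12,-\tfrac{\sqrt{35}}2)$. $O$ is an unstable spiral (the eigenvalues of the linearization are non-real with positive real part), $A$ is an unstable node (the eigenvalues are real and positive, possibly equal), and $B$ is a saddle (the eigenvalues are real with opposite signs). 2. The circle $x^2+y^2=1$ is an attracting limit cycle: it is a closed orbit, and it is the $\omega$-limit set of every trajectory starting in some neighbourhood of it. It is the only closed orbit in the plane. 3. The two open arcs $x<\tfrac12$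 and $x>\tfrac12$ of the circle $x^2+y^2=9$ are heteroclinic orbits from $A$ to $B$. 4. There is an attracting limit cycle at infinity: for the extension of the system to the Poincaré sphere $X^2+Y^2+Z^2=1$ (the central projection $x=X/Z$, $y=Y/Z$ of the system, with time rescaled by the factor $Z^{m-1}$, where $m$ is the maximum of the degrees of the two right-hand sides), the equator $Z=0$ is a closed orbit, and it is the $\omega$-limit set of every trajectory that starts in the closed upper hemisphere $Z\ge 0$ sufficiently near the equator. The polynomial $W=x^2+y^2+1$ satisfies the assumptions. The resulting system, called R4, is $$\frac{dx}{dt}=x(x^2+y^2-1)(x^2+y^2-9)-y(x^2+y^2-2x-8)(x^2+y^2+1),$$ $$\frac{dy}{dt}=y(x^2+y^2-1)(x^2+y^2-9)+x(x^2+y^2-2x-8)(x^2+y^2+1),$$ and it therefore has all of these features. -/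

import Mathlib

open MvPolynomial Set Filter Topology

noncomputable section

/-- A polynomial system `dx/dt = P(x, y)`, `dy/dt = Q(x, y)` in the plane: the pair `(P, Q)`, in the
variables `x = X 0` and `y = X 1`. Points of the plane are the elements of `Fin 2 → ℝ`. -/
abbrev PlanarSystem := Fin 2 → MvPolynomial (Fin 2) ℝ

namespace PlanarSystem

/-- The vector field on the plane given by the system. -/
def field (F : PlanarSystem) (p : Fin 2 → ℝ) : Fin 2 → ℝ :=
  fun i => eval p (F i)

/-- The degree `max (deg P) (deg Q)` of the system. -/
def degree (F : PlanarSystem) : ℕ :=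
  max (F 0).totalDegree (F 1).totalDegree

/-- The Jacobian matrix of the system at `p`. -/
def jacobian (F : PlanarSystem) (p : Fin 2 → ℝ) : Matrix (Fin 2) (Fin 2) ℝ :=
  Matrix.of fun i j => eval p (pderiv j (F i))

/-- `z` is a (complex) eigenvalue of the linearization of the system at `p`. -/
def IsEigenvalueAt (F : PlanarSystem) (p : Fin 2 → ℝ) (z : ℂ) : Prop :=
  ((F.jacobian p).map Complex.ofReal).charpoly.IsRoot z

/-- `p` is an unstable spiral: a fixed point at which the eigenvalues of the linearization are
not real and have positive real part. -/
def IsUnstableSpiral (F : PlanarSystem) (p : Fin 2 → ℝ) : Prop :=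
  F.field p = 0 ∧ ∀ z : ℂ, F.IsEigenvalueAt p z → 0 < z.re ∧ z.im ≠ 0

/-- `p` is an unstable node: a fixed point at which the eigenvalues of the linearization are
real and positive (they may coincide). -/
def IsUnstableNode (F : PlanarSystem) (p : Fin 2 → ℝ) : Prop :=
  F.field p = 0 ∧ ∀ z : ℂ, F.IsEigenvalueAt p z → 0 < z.re ∧ z.im = 0

/-- `p` is a saddle: a fixed point at which the linearization has two real eigenvalues of
opposite signs. -/
def IsSaddle (F : PlanarSystem) (p : Fin 2 → ℝ) : Prop :=
  F.field p = 0 ∧ ∃ a b : ℝ, a < 0 ∧ 0 < b ∧ F.IsEigenvalueAt p a ∧ F.IsEigenvalueAt p b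

/-- For a polynomial `R` of degree at most `m`, the value at `u = (X, Y, Z)` of its homogenization
of degree `m`: it is `Z ^ m * R (X / Z, Y / Z)` for `Z ≠ 0`, and `R_m (X, Y)` for `Z = 0`. -/
def homogenized (m : ℕ) (R : MvPolynomial (Fin 2) ℝ) (u : Fin 3 → ℝ) : ℝ :=
  ∑ k ∈ Finset.range (m + 1), u 2 ^ (m - k) * eval ![u 0, u 1] (homogeneousComponent k R)

/-- The extension of a system of degree `m` to the Poincaré sphere `X² + Y² + Z² = 1`.
Under the central projection `(x, y) = (X / Z, Y / Z)` of the open upper hemisphere `Z > 0` onto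
the plane, this is the vector field of the system multiplied by the positive function `Z ^ (m - 1)`
(a change of the time scale). The equator `Z = 0` is invariant. With
`P* = Z ^ m P(X / Z, Y / Z)` and `Q* = Z ^ m Q(X / Z, Y / Z)` it reads
`X' = P* - X (X P* + Y Q*)`, `Y' = Q* - Y (X P* + Y Q*)`, `Z' = - Z (X P* + Y Q*)`. -/
def poincareField (F : PlanarSystem) (u : Fin 3 → ℝ) : Fin 3 → ℝ :=
  let P := homogenized F.degree (F 0) u
  let Q := homogenized F.degree (F 1) u
  let S := u 0 * P + u 1 * Q
  ![P - u 0 * S, Q - u 1 * S, - (u 2 * S)]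

end PlanarSystem

/-- The closed upper hemisphere of the Poincaré sphere. -/
def upperHemisphere : Set (Fin 3 → ℝ) :=
  {u | u 0 ^ 2 + u 1 ^ 2 + u 2 ^ 2 = 1 ∧ 0 ≤ u 2}

/-- The equator of the Poincaré sphere, whose points are the points at infinity. -/
def equator : Set (Fin 3 → ℝ) :=
  {u | u 0 ^ 2 + u 1 ^ 2 = 1 ∧ u 2 = 0}

section Dynamics

variable {E : Type*} [NormedAddCommGroup E] [NormedSpace ℝ E]

/-- The ω-limit set of a curve: the points it returns arbitrarily close to at arbitrarily
late times. -/
def omegaLimitSet (γ : ℝ → E) : Set E :=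
  {p | MapClusterPt p atTop γ}

/-- `Γ` is a cycle (closed orbit) of the vector field `v`: the orbit of a nonconstant periodic
solution. -/
def IsCycle (v : E → E) (Γ : Set E) : Prop :=
  ∃ (γ : ℝ → E) (T : ℝ), 0 < T ∧ IsIntegralCurve γ (fun _ => v) ∧ Function.Periodic γ T ∧
    (∃ t, γ t ≠ γ 0) ∧ range γ = Γ

/-- `Γ` is an attracting (stable) limit cycle of the vector field `v` on the phase space `S`:
it is a cycle, and it is the ω-limit set of every trajectory that starts at a point of `S` in some
neighbourhood of `Γ` (such trajectories being defined for all positive times). -/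
def IsAttractingLimitCycle (v : E → E) (S Γ : Set E) : Prop :=
  Γ ⊆ S ∧ IsCycle v Γ ∧
    ∃ U : Set E, IsOpen U ∧ Γ ⊆ U ∧ ∀ p ∈ U ∩ S,
      (∃ γ : ℝ → E, γ 0 = p ∧ IsIntegralCurveOn γ (fun _ => v) (Ici 0)) ∧
      ∀ γ : ℝ → E, γ 0 = p → IsIntegralCurveOn γ (fun _ => v) (Ici 0) → omegaLimitSet γ = Γ

/-- `Γ` is a heteroclinic orbit of the vector field `v`, running from the fixed point `a` to the
fixed point `b ≠ a`. -/
def IsHeteroclinicOrbit (v : E → E) (a b : E) (Γ : Set E) : Prop :=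
  a ≠ b ∧ v a = 0 ∧ v b = 0 ∧
    ∃ γ : ℝ → E, IsIntegralCurve γ (fun _ => v) ∧ Tendsto γ atBot (𝓝 a) ∧
      Tendsto γ atTop (𝓝 b) ∧ range γ = Γ

end Dynamics

/-- Poincaré's printed fourth example with its rotational term multiplied by `W`:
`dx/dt = x (x² + y² - 1) (x² + y² - 9) - y (x² + y² - 2x - 8) W(x, y)`,
`dy/dt = y (x² + y² - 1) (x² + y² - 9) + x (x² + y² - 2x - 8) W(x, y)`. -/
def modifiedP4 (W : MvPolynomial (Fin 2) ℝ) : PlanarSystem :=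
  ![X 0 * (X 0 ^ 2 + X 1 ^ 2 - 1) * (X 0 ^ 2 + X 1 ^ 2 - 9)
      - X 1 * (X 0 ^ 2 + X 1 ^ 2 - 2 * X 0 - 8) * W,
    X 1 * (X 0 ^ 2 + X 1 ^ 2 - 1) * (X 0 ^ 2 + X 1 ^ 2 - 9)
      + X 0 * (X 0 ^ 2 + X 1 ^ 2 - 2 * X 0 - 8) * W]

/-- The replacement R4 of Poincaré's fourth example. -/
def systemR4 : PlanarSystem :=
  ![X 0 * (X 0 ^ 2 + X 1 ^ 2 - 1) * (X 0 ^ 2 + X 1 ^ 2 - 9)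
      - X 1 * (X 0 ^ 2 + X 1 ^ 2 - 2 * X 0 - 8) * (X 0 ^ 2 + X 1 ^ 2 + 1),
    X 1 * (X 0 ^ 2 + X 1 ^ 2 - 1) * (X 0 ^ 2 + X 1 ^ 2 - 9)
      + X 0 * (X 0 ^ 2 + X 1 ^ 2 - 2 * X 0 - 8) * (X 0 ^ 2 + X 1 ^ 2 + 1)]

/-- The admissible factors: `W` has degree at least `2`, is positive on the whole plane, and its
homogeneous part of top degree is positive definite. -/
def IsAdmissibleFactor (W : MvPolynomial (Fin 2) ℝ) : Prop :=
  (∀ p : Fin 2 → ℝ, 0 < eval p W) ∧ 2 ≤ W.totalDegree ∧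
    ∀ p : Fin 2 → ℝ, p ≠ 0 → 0 < eval p (homogeneousComponent W.totalDegree W)

/-- The fixed point `O`. -/
def pointO : Fin 2 → ℝ := ![0, 0]

/-- The fixed point `A`. -/
def pointA : Fin 2 → ℝ := ![1 / 2, √35 / 2]

/-- The fixed point `B`. -/
def pointB : Fin 2 → ℝ := ![1 / 2, -√35 / 2]

/-- The system has the features that Poincaré lists for his fourth example. -/
structure HasP4PhasePortrait (F : PlanarSystem) : Prop where
  /-- The fixed points are exactly `O`, `A` and `B`. -/
  fixedPoints : {p | F.field p = 0} = {pointO, pointA, pointB}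
  spiral_O : F.IsUnstableSpiral pointO
  node_A : F.IsUnstableNode pointA
  saddle_B : F.IsSaddle pointB
  /-- The circle `r = 1` is an attracting limit cycle. -/
  limitCycle : IsAttractingLimitCycle F.field univ {p | p 0 ^ 2 + p 1 ^ 2 = 1}
  /-- There is no other cycle in the finite plane. -/
  cycle_unique : ∀ Γ, IsCycle F.field Γ → Γ = {p | p 0 ^ 2 + p 1 ^ 2 = 1}
  /-- The arc of the circle `r = 3` to the left of `A` and `B` is a heteroclinic orbit. -/
  heteroclinic_left :
    IsHeteroclinicOrbit F.field pointA pointB {p | p 0 ^ 2 + p 1 ^ 2 = 9 ∧ p 0 < 1 / 2}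
  /-- The arc of the circle `r = 3` to the right of `A` and `B` is a heteroclinic orbit. -/
  heteroclinic_right :
    IsHeteroclinicOrbit F.field pointA pointB {p | p 0 ^ 2 + p 1 ^ 2 = 9 ∧ 1 / 2 < p 0}
  /-- The equator of the Poincaré sphere is an attracting limit cycle. -/
  limitCycle_infinity : IsAttractingLimitCycle F.poincareField upperHemisphere equator

end

/-! ### Ordinary differential equations -/

/-! ### Global existence of integral curves by truncation -/

section GlobalExistence

variable {E : Type*} [NormedAddCommGroup E] [NormedSpace ℝ E]

/-! In polar coordinates the system is r'/r = (r² - 1)(r² - 9), θ' = (r² - 2x - 8) W. Each of r², r²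
- 1 and r² - 9 therefore solves a scalar linear equation f' = a(t) f along every trajectory, so it
keeps its sign; in particular the circles r = 1 and r = 3 are invariant. Near r = 1 one has r² - 2x
- 8 < 0, so θ' ≤ -c while r² → 1 exponentially: trajectories wind onto the circle. On any closed
orbit r² has a critical point by Rolle, so the orbit lies on r = 0, 1 or 3. On r = 3 one has θ' = (1
- 2x) W, and a stereographic coordinate is strictly monotone on each arc cut off by x = 1/2; this
excludes cycles there and makes each arc run from `A` to `B`. The extension to the sphere has the
same shape: a rotation with homogenized angular velocity, bounded below near the equator because W >
0 and W_N is definite, together with a height Z that decreases to 0. Solutions are produced by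
cutting the field off with a bump function. The invariance lemmas are stated for all rescalings `φ •
v`, so that they confine the truncated solutions to the region where `φ = 1`. -/

theorem IsIntegralCurve.periodic_of_lipschitz {v : E → E} {K : NNReal} (hv : LipschitzWith K v)
    {γ : ℝ → E} (hγ : IsIntegralCurve γ (fun _ => v)) {T : ℝ} (hT : γ T = γ 0) :
    Function.Periodic γ T := by
  have h := ODE_solution_unique_univ (v := fun _ => v) (s := fun _ => univ) (K := K) (t₀ := 0)
    (f := γ ∘ (· + T)) (g := γ) (fun _ => hv.lipschitzOnWith)
    (fun t => ⟨(hγ.comp_add T) t, mem_univ _⟩) (fun t => ⟨hγ t, mem_univ _⟩) (by simpa using hT)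
  exact fun t => congrFun h t

/-- A bounded Lipschitz vector field is complete. -/
theorem exists_isIntegralCurve_of_lipschitz [CompleteSpace E] {v : E → E} {K L : NNReal}
    (hv : LipschitzWith K v) (hL : ∀ x, ‖v x‖ ≤ L) (x : E) :
    ∃ γ : ℝ → E, γ 0 = x ∧ IsIntegralCurve γ (fun _ => v) := by
  have hloc : ∀ n : ℕ, ∃ α : ℝ → E, α 0 = x ∧
      ∀ t ∈ Ioo (-(n : ℝ)) n, HasDerivAt α (v (α t)) t := by
    intro n
    have hn : (0 : ℝ) ∈ Icc (-(n : ℝ)) n := ⟨by simp, by simp⟩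
    -- A curve of speed at most `L` travels at most `L * n` in time `n`, so a ball of that radius
    -- never obstructs the solution.
    have hpl : IsPicardLindelof (fun _ => v) (⟨0, hn⟩ : Icc (-(n : ℝ)) n) x (L * n) 0 L K :=
      { lipschitzOnWith := fun _ _ => hv.lipschitzOnWith
        continuousOn := fun _ _ => continuousOn_const
        norm_le := fun _ _ y _ => hL y
        mul_max_le := by simp }
    obtain ⟨α, h0, hα⟩ := hpl.exists_eq_forall_mem_Icc_hasDerivWithinAt₀
    exact ⟨α, h0, fun t ht => (hα t (Ioo_subset_Icc_self ht)).hasDerivAt (Icc_mem_nhds ht.1 ht.2)⟩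
  choose α h0 hα using hloc
  have hagree : ∀ m n : ℕ, m ≤ n → EqOn (α m) (α n) (Ioo (-(m : ℝ)) m) := by
    intro m n hmn t ht
    have hmn' : (m : ℝ) ≤ n := by exact_mod_cast hmn
    have hm : (0 : ℝ) < m := by linarith [ht.1, ht.2]
    exact ODE_solution_unique_of_mem_Ioo (v := fun _ => v) (s := fun _ => univ) (K := K) (t₀ := 0)
      (fun _ _ => hv.lipschitzOnWith) ⟨by linarith, hm⟩
      (fun t ht => ⟨hα m t ht, mem_univ _⟩)
      (fun t ht => ⟨hα n t ⟨by linarith [ht.1], by linarith [ht.2]⟩, mem_univ _⟩)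
      ((h0 m).trans (h0 n).symm) ht
  have hmem : ∀ t : ℝ, t ∈ Ioo (-((⌊|t|⌋₊ + 1 : ℕ) : ℝ)) ((⌊|t|⌋₊ + 1 : ℕ) : ℝ) := by
    intro t
    have := Nat.lt_floor_add_one |t|
    push_cast
    exact abs_lt.1 this
  -- At time `t`, use the first local solution whose interval contains `t`. Nearby times need no
  -- larger index, so there the glued curve agrees with this single solution.
  refine ⟨fun t => α (⌊|t|⌋₊ + 1) t, h0 _, fun t => ?_⟩
  have hev : (fun t => α (⌊|t|⌋₊ + 1) t) =ᶠ[𝓝 t] α (⌊|t|⌋₊ + 1) := by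
    filter_upwards [Ioo_mem_nhds (hmem t).1 (hmem t).2] with u hu
    refine hagree _ _ ?_ (hmem u)
    have : |u| < ((⌊|t|⌋₊ + 1 : ℕ) : ℝ) := abs_lt.2 hu
    exact (Nat.floor_lt (abs_nonneg u)).2 this
  exact (hα _ t (hmem t)).congr_of_eventuallyEq hev

/-- A point has a global integral curve, provided that the integral curves of all rescalings of the
vector field that pass through the point stay in one bounded set. -/
theorem exists_isIntegralCurve_of_trapped [FiniteDimensional ℝ E] {v : E → E}
    (hv : ContDiff ℝ 1 v) {p : E} {S : Set E} (hS : Bornology.IsBounded S)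
    (h : ∀ (φ : E → ℝ) (γ : ℝ → E), Continuous φ → γ 0 = p →
      IsIntegralCurve γ (fun _ x => φ x • v x) → ∀ t, γ t ∈ S) :
    ∃ γ : ℝ → E, γ 0 = p ∧ IsIntegralCurve γ (fun _ => v) ∧ (∀ t, γ t ∈ S) ∧
      ∀ T, γ T = γ 0 → Function.Periodic γ T := by
  have := FiniteDimensional.complete ℝ E
  obtain ⟨r, hr0, hr⟩ := hS.subset_closedBall_lt 0 0
  -- The bump equals 1 on a ball containing `S`. The truncated field is compactly supported, hence
  -- bounded and Lipschitz, and its curve through `p` stays in `S`, where it is a curve of `v`.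
  let φ : ContDiffBump (0 : E) := ⟨r, r + 1, hr0, by linarith⟩
  have hφv : ContDiff ℝ 1 (fun x => φ x • v x) := φ.contDiff.smul hv
  have hsupp : HasCompactSupport (fun x => φ x • v x) := φ.hasCompactSupport.smul_right
  obtain ⟨K, hK⟩ := hφv.lipschitzWith_of_hasCompactSupport hsupp one_ne_zero
  obtain ⟨L, hL⟩ := hsupp.exists_bound_of_continuous hφv.continuous
  obtain ⟨γ, h0, hγ⟩ := exists_isIntegralCurve_of_lipschitz (L := L.toNNReal) hK
    (fun x => (hL x).trans (Real.le_coe_toNNReal L)) p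
  have hmem := h φ γ φ.continuous h0 hγ
  refine ⟨γ, h0, fun t => ?_, hmem, fun T hT => hγ.periodic_of_lipschitz hK hT⟩
  have h1 : φ (γ t) = 1 := φ.one_of_mem_closedBall (hr (hmem t))
  simpa [h1] using hγ t

end GlobalExistence

/-! ### Linear equations along a curve: signs, decay and winding -/

section Linear

/-- Integrating factor: f · exp(-∫ a) has zero derivative on a convex set. Complex coefficients
allow the modulus and angle of a planar curve to be read off together. -/
theorem eq_mul_cexp_of_hasDerivWithinAt {s : Set ℝ} (hs : Convex ℝ s) (h0 : (0 : ℝ) ∈ s)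
    {a f : ℝ → ℂ} (ha : Continuous a) (hf : ∀ t ∈ s, HasDerivWithinAt f (a t * f t) s t)
    {t : ℝ} (ht : t ∈ s) : f t = f 0 * Complex.exp (∫ u in (0 : ℝ)..t, a u) := by
  let A : ℝ → ℂ := fun t => ∫ u in (0 : ℝ)..t, a u
  have hA : ∀ t, HasDerivAt A (a t) t := fun t => ha.integral_hasStrictDerivAt 0 t |>.hasDerivAt
  have hg : ∀ t ∈ s, HasDerivWithinAt (fun t => f t * Complex.exp (-A t)) 0 s t := by
    intro t ht
    have := (hf t ht).mul ((hA t).hasDerivWithinAt (s := s)).neg.cexp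
    refine this.congr_deriv ?_
    ring
  have h := hs.norm_image_sub_le_of_norm_hasDerivWithin_le (C := 0) hg (by simp) h0 ht
  have h' : f t * Complex.exp (-A t) = f 0 := by
    have : A 0 = 0 := by simp [A]
    simpa [this, sub_eq_zero] using h
  rw [← h', mul_assoc, ← Complex.exp_add]
  simp [A]

theorem eq_mul_exp_of_hasDerivWithinAt {s : Set ℝ} (hs : Convex ℝ s) (h0 : (0 : ℝ) ∈ s)
    {a f : ℝ → ℝ} (ha : Continuous a) (hf : ∀ t ∈ s, HasDerivWithinAt f (a t * f t) s t)
    {t : ℝ} (ht : t ∈ s) : f t = f 0 * Real.exp (∫ u in (0 : ℝ)..t, a u) := by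
  have h := eq_mul_cexp_of_hasDerivWithinAt hs h0 (a := fun t => (a t : ℂ))
    (f := fun t => (f t : ℂ)) (by fun_prop)
    (fun t ht => by simpa using (hf t ht).ofReal_comp) ht
  rw [intervalIntegral.integral_ofReal] at h
  exact_mod_cast h

/-- The sign of a solution of a scalar linear equation never changes. -/
theorem exists_pos_eq_mul_of_hasDerivWithinAt {s : Set ℝ} (hs : Convex ℝ s) (h0 : (0 : ℝ) ∈ s)
    {a f : ℝ → ℝ} (ha : Continuous a) (hf : ∀ t ∈ s, HasDerivWithinAt f (a t * f t) s t)
    {t : ℝ} (ht : t ∈ s) : ∃ e, 0 < e ∧ f t = f 0 * e :=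
  ⟨_, Real.exp_pos _, eq_mul_exp_of_hasDerivWithinAt hs h0 ha hf ht⟩

theorem tendsto_zero_of_hasDerivWithinAt {a f : ℝ → ℝ} (ha : Continuous a)
    (hf : ∀ t ∈ Ici (0 : ℝ), HasDerivWithinAt f (a t * f t) (Ici 0) t) {c : ℝ} (hc : 0 < c)
    (hac : ∀ t, 0 ≤ t → a t ≤ -c) : Tendsto f atTop (𝓝 0) := by
  have hlim : Tendsto (fun t : ℝ => |f 0| * Real.exp (-(c * t))) atTop (𝓝 0) := by
    have h1 : Tendsto (fun t : ℝ => c * t) atTop atTop := tendsto_id.const_mul_atTop hc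
    simpa using (Real.tendsto_exp_neg_atTop_nhds_zero.comp h1).const_mul |f 0|
  refine squeeze_zero_norm' ?_ hlim
  filter_upwards [eventually_ge_atTop 0] with t ht
  rw [eq_mul_exp_of_hasDerivWithinAt (convex_Ici 0) self_mem_Ici ha hf ht, norm_mul,
    Real.norm_eq_abs, Real.norm_eq_abs, Real.abs_exp]
  gcongr
  have := intervalIntegral.integral_mono_on (μ := MeasureTheory.volume) (f := a) (g := fun _ => -c) ht
    (ha.intervalIntegrable _ _) (continuous_const.intervalIntegrable _ _) (fun u hu => hac u hu.1)
  simp at this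
  linarith

/-- The primitive of `b` is continuous and grows at least linearly, so it takes every sufficiently
large value of the progression y + 2πk, at late times. -/
theorem exists_integral_eq_of_le {b : ℝ → ℝ} (hb : Continuous b) {c : ℝ} (hc : 0 < c)
    (hbc : ∀ t, 0 ≤ t → c ≤ b t) (y M : ℝ) :
    ∃ t, 0 ≤ t ∧ M ≤ t ∧ ∃ k : ℤ, ∫ u in (0 : ℝ)..t, b u = y + k * (2 * Real.pi) := by
  set φ : ℝ → ℝ := fun t => ∫ u in (0 : ℝ)..t, b u with hφ
  have hφc : Continuous φ := intervalIntegral.continuous_primitive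
    (fun u v => hb.intervalIntegrable u v) 0
  have hφge : ∀ t, 0 ≤ t → c * t ≤ φ t := by
    intro t ht
    have := intervalIntegral.integral_mono_on (μ := MeasureTheory.volume) (f := fun _ => c) (g := b) ht
      (continuous_const.intervalIntegrable _ _) (hb.intervalIntegrable _ _) (fun u hu => hbc u hu.1)
    simp at this
    linarith
  set m := max M 0
  have hpi : (0 : ℝ) < 2 * Real.pi := by positivity
  obtain ⟨k, hk⟩ := exists_int_gt ((φ m - y) / (2 * Real.pi))
  have hk' : φ m ≤ y + k * (2 * Real.pi) := by
    rw [div_lt_iff₀ hpi] at hk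
    linarith
  set Y := y + k * (2 * Real.pi)
  set N := max m (Y / c)
  have hN : Y ≤ φ N := by
    have h0 : 0 ≤ N := (le_max_right M 0).trans (le_max_left _ _)
    refine le_trans ?_ (hφge N h0)
    have : Y / c ≤ N := le_max_right _ _
    rw [div_le_iff₀ hc] at this
    linarith
  obtain ⟨t, ht, hty⟩ := intermediate_value_Icc (le_max_left m (Y / c)) hφc.continuousOn ⟨hk', hN⟩
  exact ⟨t, (le_max_right M 0).trans ht.1, (le_max_left M 0).trans ht.1, k, hty⟩

/-- If the angular velocity of a curve in the punctured plane is bounded away from zero, then the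
curve crosses every ray at arbitrarily late times. -/
theorem exists_ge_eq_norm_mul {z : ℝ → ℂ} {a b : ℝ → ℝ} (ha : Continuous a) (hb : Continuous b)
    (hz : ∀ t ∈ Ici (0 : ℝ),
      HasDerivWithinAt z (((a t : ℂ) + b t * Complex.I) * z t) (Ici 0) t)
    {c : ℝ} (hc : 0 < c) (hbc : (∀ t, 0 ≤ t → c ≤ b t) ∨ ∀ t, 0 ≤ t → b t ≤ -c)
    {w : ℂ} (hw : ‖w‖ = 1) (M : ℝ) : ∃ t, 0 ≤ t ∧ M ≤ t ∧ z t = ‖z t‖ * w := by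
  -- The accumulated angle ∫ b only has to equal arg w - arg z(0) modulo 2π; clockwise motion
  -- reduces to the other case by negating `b`.
  have hangle : ∃ t, 0 ≤ t ∧ M ≤ t ∧
      ∃ k : ℤ, ∫ u in (0 : ℝ)..t, b u = (w.arg - (z 0).arg) + k * (2 * Real.pi) := by
    rcases hbc with h | h
    · exact exists_integral_eq_of_le hb hc h _ M
    · obtain ⟨t, ht0, htM, k, hk⟩ := exists_integral_eq_of_le (b := fun t => -b t) hb.neg hc
        (fun t ht => by linarith [h t ht]) (-(w.arg - (z 0).arg)) M
      refine ⟨t, ht0, htM, -k, ?_⟩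
      rw [intervalIntegral.integral_neg] at hk
      push_cast
      linarith
  obtain ⟨t, ht0, htM, k, hk⟩ := hangle
  refine ⟨t, ht0, htM, ?_⟩
  have hzt := eq_mul_cexp_of_hasDerivWithinAt (convex_Ici 0) self_mem_Ici
    (a := fun t => (a t : ℂ) + b t * Complex.I) (by fun_prop) hz ht0
  have hint : ∫ u in (0 : ℝ)..t, ((a u : ℂ) + b u * Complex.I) =
      ((∫ u in (0 : ℝ)..t, a u : ℝ) : ℂ) + ((∫ u in (0 : ℝ)..t, b u : ℝ) : ℂ) * Complex.I := by
    rw [intervalIntegral.integral_add, intervalIntegral.integral_ofReal,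
      intervalIntegral.integral_mul_const, intervalIntegral.integral_ofReal]
    · exact (by fun_prop : Continuous fun u => (a u : ℂ)).intervalIntegrable _ _
    · exact (by fun_prop : Continuous fun u => (b u : ℂ) * Complex.I).intervalIntegrable _ _
  have key : z t = ((‖z 0‖ * Real.exp (∫ u in (0 : ℝ)..t, a u) : ℝ) : ℂ) * w := by
    have hz0 := Complex.norm_mul_exp_arg_mul_I (z 0)
    have hw0 := Complex.norm_mul_exp_arg_mul_I w
    rw [hzt, hint, hk]
    generalize (z 0).arg = α at hz0 ⊢
    generalize w.arg = β at hw0 ⊢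
    conv_lhs => rw [← hz0]
    conv_rhs => rw [← hw0, hw]
    push_cast
    rw [mul_assoc, mul_assoc, ← Complex.exp_add, one_mul, ← Complex.exp_add]
    congr 1
    rw [Complex.exp_eq_exp_iff_exists_int]
    exact ⟨k, by ring⟩
  have hnorm : ‖z t‖ = ‖z 0‖ * Real.exp (∫ u in (0 : ℝ)..t, a u) := by
    rw [key, norm_mul, hw, mul_one, Complex.norm_real, Real.norm_of_nonneg (by positivity)]
  rw [hnorm]
  exact key

/-- This is the equation z' = (a + bi) z for z = x + iy, written in real coordinates. -/
theorem exists_ge_eq_sqrt_mul {x y a b : ℝ → ℝ} (ha : Continuous a) (hb : Continuous b)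
    (hx : ∀ t ∈ Ici (0 : ℝ), HasDerivWithinAt x (a t * x t - b t * y t) (Ici 0) t)
    (hy : ∀ t ∈ Ici (0 : ℝ), HasDerivWithinAt y (a t * y t + b t * x t) (Ici 0) t)
    {c : ℝ} (hc : 0 < c) (hbc : (∀ t, 0 ≤ t → c ≤ b t) ∨ ∀ t, 0 ≤ t → b t ≤ -c)
    {p q : ℝ} (hpq : p ^ 2 + q ^ 2 = 1) (M : ℝ) :
    ∃ t, 0 ≤ t ∧ M ≤ t ∧ x t = √(x t ^ 2 + y t ^ 2) * p ∧ y t = √(x t ^ 2 + y t ^ 2) * q := by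
  have hw : ‖(⟨p, q⟩ : ℂ)‖ = 1 := by
    rw [Complex.norm_eq_sqrt_sq_add_sq]
    simp [hpq]
  obtain ⟨t, ht0, htM, h⟩ := exists_ge_eq_norm_mul (z := fun t => (x t : ℂ) + y t * Complex.I)
    ha hb (fun t ht => by
      refine ((hx t ht).ofReal_comp.add ((hy t ht).ofReal_comp.mul_const Complex.I)).congr_deriv ?_
      push_cast
      linear_combination -(b t * y t : ℂ) * Complex.I_sq) hc hbc hw M
  refine ⟨t, ht0, htM, ?_⟩
  rw [Complex.norm_add_mul_I] at h
  exact ⟨by simpa using congrArg Complex.re h, by simpa using congrArg Complex.im h⟩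

end Linear

/-! ### General facts on integral curves and limits -/

theorem IsIntegralCurveOn.one_smul_field {E : Type*} [NormedAddCommGroup E] [NormedSpace ℝ E]
    {γ : ℝ → E} {v : E → E} {s : Set ℝ} (hγ : IsIntegralCurveOn γ (fun _ => v) s) :
    IsIntegralCurveOn γ (fun _ x => (fun _ : E => (1 : ℝ)) x • v x) s :=
  fun t ht => by simpa using hγ t ht

/-- A curve on `Ici 0` is unconstrained at negative times. Replacing it by `γ (max t 0)` makes it
continuous on all of ℝ, as the integral formulas need, and leaves its behaviour at late times
unchanged. -/
theorem omegaLimitSet_eq_of_forall_continuous {E : Type*} [NormedAddCommGroup E] [NormedSpace ℝ E]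
    {v : E → E} {p : E} {Γ : Set E}
    (h : ∀ γ : ℝ → E, Continuous γ → γ 0 = p → IsIntegralCurveOn γ (fun _ => v) (Ici 0) →
      omegaLimitSet γ = Γ)
    {γ : ℝ → E} (h0 : γ 0 = p) (hγ : IsIntegralCurveOn γ (fun _ => v) (Ici 0)) :
    omegaLimitSet γ = Γ := by
  have heq : ∀ t, 0 ≤ t → γ (max t 0) = γ t := fun t ht => by rw [max_eq_left ht]
  rw [← h (fun t => γ (max t 0)) (hγ.continuousOn.comp_continuous (by fun_prop) (by simp))
    (by simpa using h0) fun t ht => ?_]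
  · ext q
    refine Filter.EventuallyEq.mapClusterPt_iff ?_
    filter_upwards [eventually_ge_atTop 0] with t ht
    exact (heq t ht).symm
  · change HasDerivWithinAt _ (v (γ (max t 0))) _ _
    rw [heq t ht]
    exact (hγ t ht).congr (fun u hu => heq u hu) (heq t ht)

/-- By the mean value theorem on [t, t + 1], `f'` takes the value f(t + 1) - f(t) → 0 at arbitrarily
late times. -/
theorem eq_zero_of_tendsto_of_tendsto_deriv {f f' : ℝ → ℝ} (hf : ∀ t, HasDerivAt f (f' t) t)
    {L M : ℝ} (hL : Tendsto f atTop (𝓝 L)) (hM : Tendsto f' atTop (𝓝 M)) : M = 0 := by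
  have hmvt : ∀ t : ℝ, ∃ ξ ∈ Ioo t (t + 1), f' ξ = (f (t + 1) - f t) / (t + 1 - t) := fun t =>
    exists_hasDerivAt_eq_slope f f' (by linarith)
      (fun u _ => (hf u).continuousAt.continuousWithinAt) (fun u _ => hf u)
  choose ξ hξ hξ' using hmvt
  have h1 : Tendsto ξ atTop atTop := tendsto_atTop_mono (fun t => (hξ t).1.le) tendsto_id
  have h2 : Tendsto (fun t => f (t + 1) - f t) atTop (𝓝 (L - L)) :=
    (hL.comp (tendsto_atTop_add_const_right _ 1 tendsto_id)).sub hL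
  rw [sub_self] at h2
  refine tendsto_nhds_unique (hM.comp h1) (h2.congr fun t => ?_)
  simp [hξ']

theorem MvPolynomial.contDiff_eval {σ : Type*} [Fintype σ] {n : WithTop ℕ∞}
    (R : MvPolynomial σ ℝ) : ContDiff ℝ n (fun p : σ → ℝ => eval p R) := by
  induction R using MvPolynomial.induction_on with
  | C a => simpa using contDiff_const
  | add P Q hP hQ => simpa using hP.add hQ
  | mul_X P i hP => simpa using hP.mul (contDiff_apply ℝ ℝ i)

namespace PlanarSystem

theorem contDiff_field (F : PlanarSystem) {n : WithTop ℕ∞} : ContDiff ℝ n F.field :=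
  contDiff_pi.2 fun i => (F i).contDiff_eval

end PlanarSystem

/-- The angular velocity `dθ/dt` of the system `modifiedP4 W`. -/
noncomputable def angularVelocity (W : MvPolynomial (Fin 2) ℝ) (p : Fin 2 → ℝ) : ℝ :=
  (p 0 ^ 2 + p 1 ^ 2 - 2 * p 0 - 8) * eval p W

/-- The growth rate `(dr/dt) / r` of the system `modifiedP4 W`. -/
noncomputable def radialRate (p : Fin 2 → ℝ) : ℝ :=
  (p 0 ^ 2 + p 1 ^ 2 - 1) * (p 0 ^ 2 + p 1 ^ 2 - 9)

@[fun_prop]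
theorem continuous_angularVelocity (W : MvPolynomial (Fin 2) ℝ) :
    Continuous (angularVelocity W) := by
  have : Continuous fun p : Fin 2 → ℝ => eval p W := MvPolynomial.continuous_eval W
  unfold angularVelocity
  fun_prop

@[fun_prop]
theorem continuous_radialRate : Continuous radialRate := by
  unfold radialRate
  fun_prop

theorem field_modifiedP4_zero (W : MvPolynomial (Fin 2) ℝ) (p : Fin 2 → ℝ) :
    (modifiedP4 W).field p 0 = radialRate p * p 0 - angularVelocity W p * p 1 := by
  simp [modifiedP4, PlanarSystem.field, radialRate, angularVelocity]
  ring

theorem field_modifiedP4_one (W : MvPolynomial (Fin 2) ℝ) (p : Fin 2 → ℝ) :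
    (modifiedP4 W).field p 1 = radialRate p * p 1 + angularVelocity W p * p 0 := by
  simp [modifiedP4, PlanarSystem.field, radialRate, angularVelocity]
  ring

/-! ### Invariant circles of the planar system -/

section Curves

variable {W : MvPolynomial (Fin 2) ℝ} {φ : (Fin 2 → ℝ) → ℝ} {γ : ℝ → Fin 2 → ℝ} {s : Set ℝ}

theorem hasDerivWithinAt_coord_zero
    (hγ : IsIntegralCurveOn γ (fun _ x => φ x • (modifiedP4 W).field x) s) {t : ℝ} (ht : t ∈ s) :
    HasDerivWithinAt (fun t => γ t 0) (φ (γ t) * radialRate (γ t) * γ t 0 -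
      φ (γ t) * angularVelocity W (γ t) * γ t 1) s t := by
  refine (hasDerivWithinAt_pi.1 (hγ t ht) 0).congr_deriv ?_
  beta_reduce
  rw [Pi.smul_apply, field_modifiedP4_zero, smul_eq_mul]
  ring

theorem hasDerivWithinAt_coord_one
    (hγ : IsIntegralCurveOn γ (fun _ x => φ x • (modifiedP4 W).field x) s) {t : ℝ} (ht : t ∈ s) :
    HasDerivWithinAt (fun t => γ t 1) (φ (γ t) * radialRate (γ t) * γ t 1 +
      φ (γ t) * angularVelocity W (γ t) * γ t 0) s t := by
  refine (hasDerivWithinAt_pi.1 (hγ t ht) 1).congr_deriv ?_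
  beta_reduce
  rw [Pi.smul_apply, field_modifiedP4_one, smul_eq_mul]
  ring

theorem hasDerivWithinAt_sq_add_sq
    (hγ : IsIntegralCurveOn γ (fun _ x => φ x • (modifiedP4 W).field x) s) {t : ℝ} (ht : t ∈ s) :
    HasDerivWithinAt (fun t => γ t 0 ^ 2 + γ t 1 ^ 2)
      (2 * φ (γ t) * radialRate (γ t) * (γ t 0 ^ 2 + γ t 1 ^ 2)) s t := by
  refine (((hasDerivWithinAt_coord_zero hγ ht).pow 2).add
    ((hasDerivWithinAt_coord_one hγ ht).pow 2)).congr_deriv ?_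
  push_cast
  ring

theorem exists_pos_sq_add_sq_eq_mul (hs : Convex ℝ s) (h0 : (0 : ℝ) ∈ s) (hφ : Continuous φ)
    (hγc : Continuous γ) (hγ : IsIntegralCurveOn γ (fun _ x => φ x • (modifiedP4 W).field x) s)
    {t : ℝ} (ht : t ∈ s) : ∃ e, 0 < e ∧ γ t 0 ^ 2 + γ t 1 ^ 2 = (γ 0 0 ^ 2 + γ 0 1 ^ 2) * e :=
  exists_pos_eq_mul_of_hasDerivWithinAt hs h0 (f := fun t => γ t 0 ^ 2 + γ t 1 ^ 2)
    (a := fun t => 2 * φ (γ t) * radialRate (γ t)) (by fun_prop)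
    (fun _ ht => hasDerivWithinAt_sq_add_sq hγ ht) ht

/-- The derivative of r² is 2φ r²(r² - 1)(r² - 9), so r² - 1 divides its own derivative; likewise
for r² and r² - 9. -/
theorem exists_pos_sq_add_sq_sub_one_eq_mul (hs : Convex ℝ s) (h0 : (0 : ℝ) ∈ s)
    (hφ : Continuous φ) (hγc : Continuous γ)
    (hγ : IsIntegralCurveOn γ (fun _ x => φ x • (modifiedP4 W).field x) s)
    {t : ℝ} (ht : t ∈ s) :
    ∃ e, 0 < e ∧ γ t 0 ^ 2 + γ t 1 ^ 2 - 1 = (γ 0 0 ^ 2 + γ 0 1 ^ 2 - 1) * e :=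
  exists_pos_eq_mul_of_hasDerivWithinAt hs h0 (f := fun t => γ t 0 ^ 2 + γ t 1 ^ 2 - 1)
    (a := fun t => 2 * φ (γ t) * (γ t 0 ^ 2 + γ t 1 ^ 2 - 9) * (γ t 0 ^ 2 + γ t 1 ^ 2))
    (by fun_prop) (fun _ ht => ((hasDerivWithinAt_sq_add_sq hγ ht).sub_const 1).congr_deriv
      (by unfold radialRate; ring)) ht

theorem exists_pos_sq_add_sq_sub_nine_eq_mul (hs : Convex ℝ s) (h0 : (0 : ℝ) ∈ s)
    (hφ : Continuous φ) (hγc : Continuous γ)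
    (hγ : IsIntegralCurveOn γ (fun _ x => φ x • (modifiedP4 W).field x) s)
    {t : ℝ} (ht : t ∈ s) :
    ∃ e, 0 < e ∧ γ t 0 ^ 2 + γ t 1 ^ 2 - 9 = (γ 0 0 ^ 2 + γ 0 1 ^ 2 - 9) * e :=
  exists_pos_eq_mul_of_hasDerivWithinAt hs h0 (f := fun t => γ t 0 ^ 2 + γ t 1 ^ 2 - 9)
    (a := fun t => 2 * φ (γ t) * (γ t 0 ^ 2 + γ t 1 ^ 2 - 1) * (γ t 0 ^ 2 + γ t 1 ^ 2))
    (by fun_prop) (fun _ ht => ((hasDerivWithinAt_sq_add_sq hγ ht).sub_const 9).congr_deriv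
      (by unfold radialRate; ring)) ht

end Curves

theorem isBounded_sq_add_sq_le (r : ℝ) :
    Bornology.IsBounded {p : Fin 2 → ℝ | p 0 ^ 2 + p 1 ^ 2 ≤ r} := by
  refine (Metric.isBounded_closedBall (x := (0 : Fin 2 → ℝ)) (r := √r)).subset fun p hp => ?_
  have hp' : p 0 ^ 2 + p 1 ^ 2 ≤ r := hp
  rw [mem_closedBall_zero_iff, pi_norm_le_iff_of_nonneg (Real.sqrt_nonneg r)]
  intro i
  refine Real.abs_le_sqrt ?_
  fin_cases i
  · show p 0 ^ 2 ≤ r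
    nlinarith
  · show p 1 ^ 2 ≤ r
    nlinarith

/-! ### The limit cycle r = 1 -/

section UnitCircle

variable {W : MvPolynomial (Fin 2) ℝ}

theorem exists_angularVelocity_le (hW : ∀ p, 0 < eval p W) :
    ∃ c, 0 < c ∧ ∀ p : Fin 2 → ℝ, |p 0 ^ 2 + p 1 ^ 2 - 1| ≤ 1 / 2 → angularVelocity W p ≤ -c := by
  have hK : IsCompact {p : Fin 2 → ℝ | |p 0 ^ 2 + p 1 ^ 2 - 1| ≤ 1 / 2} := by
    refine Metric.isCompact_of_isClosed_isBounded (isClosed_le (by fun_prop) (by fun_prop))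
      ((isBounded_sq_add_sq_le (3 / 2)).subset fun p hp => ?_)
    have := (abs_le.1 (show |p 0 ^ 2 + p 1 ^ 2 - 1| ≤ 1 / 2 from hp)).2
    show p 0 ^ 2 + p 1 ^ 2 ≤ 3 / 2
    linarith
  obtain ⟨c, hc, h⟩ := hK.exists_forall_le' (f := fun p => -angularVelocity W p)
    (by fun_prop) (a := 0) (fun p hp => by
      have := (abs_le.1 (show |p 0 ^ 2 + p 1 ^ 2 - 1| ≤ 1 / 2 from hp)).2
      -- Since -2x ≤ x² + 1, the left side is at most 2r² - 7 ≤ -4.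
      have h1 : p 0 ^ 2 + p 1 ^ 2 - 2 * p 0 - 8 < 0 := by
        nlinarith [sq_nonneg (p 0 + 1), sq_nonneg (p 1)]
      have := mul_neg_of_neg_of_pos h1 (hW p)
      unfold angularVelocity
      linarith)
  exact ⟨c, hc, fun p hp => by linarith [h p hp]⟩

/-- Trajectories that stay near the unit circle go around it forever. -/
theorem exists_ge_eq_sqrt_mul_of_near_circle (hW : ∀ p, 0 < eval p W) {γ : ℝ → Fin 2 → ℝ}
    (hγc : Continuous γ) (hγ : IsIntegralCurveOn γ (fun _ => (modifiedP4 W).field) (Ici 0))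
    (hnear : ∀ t, 0 ≤ t → |γ t 0 ^ 2 + γ t 1 ^ 2 - 1| ≤ 1 / 2) {p : Fin 2 → ℝ}
    (hp : p 0 ^ 2 + p 1 ^ 2 = 1) (M : ℝ) :
    ∃ t, M ≤ t ∧ γ t = √(γ t 0 ^ 2 + γ t 1 ^ 2) • p := by
  obtain ⟨c, hc, h⟩ := exists_angularVelocity_le hW
  have hγ' := hγ.one_smul_field
  obtain ⟨t, -, htM, hx, hy⟩ := exists_ge_eq_sqrt_mul (x := fun t => γ t 0) (y := fun t => γ t 1)
    (a := fun t => 1 * radialRate (γ t)) (b := fun t => 1 * angularVelocity W (γ t))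
    (by fun_prop) (by fun_prop)
    (fun t ht => hasDerivWithinAt_coord_zero hγ' ht) (fun t ht => hasDerivWithinAt_coord_one hγ' ht)
    hc (Or.inr fun t ht => by simpa using h _ (hnear t ht)) hp M
  refine ⟨t, htM, funext fun i => ?_⟩
  fin_cases i
  · exact hx
  · exact hy

theorem sq_add_sq_eq_one_of_isIntegralCurve {φ : (Fin 2 → ℝ) → ℝ} (hφ : Continuous φ)
    {γ : ℝ → Fin 2 → ℝ} (hγ : IsIntegralCurve γ (fun _ x => φ x • (modifiedP4 W).field x))
    (h0 : γ 0 0 ^ 2 + γ 0 1 ^ 2 = 1) (t : ℝ) : γ t 0 ^ 2 + γ t 1 ^ 2 = 1 := by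
  obtain ⟨e, -, he⟩ := exists_pos_sq_add_sq_sub_one_eq_mul convex_univ (mem_univ _) hφ
    hγ.continuous (hγ.isIntegralCurveOn univ) (mem_univ t)
  rw [h0, sub_self, zero_mul] at he
  linarith

/-- The solution stays on the invariant circle and its angular velocity is bounded away from zero,
so it meets every ray. -/
theorem range_eq_circle (hW : ∀ p, 0 < eval p W) {γ : ℝ → Fin 2 → ℝ}
    (hγ : IsIntegralCurve γ (fun _ => (modifiedP4 W).field))
    (h0 : γ 0 0 ^ 2 + γ 0 1 ^ 2 = 1) : range γ = {p | p 0 ^ 2 + p 1 ^ 2 = 1} := by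
  have hone : ∀ t, γ t 0 ^ 2 + γ t 1 ^ 2 = 1 := sq_add_sq_eq_one_of_isIntegralCurve (W := W)
    (φ := fun _ => 1) continuous_const (by simpa using hγ) h0
  refine Subset.antisymm (range_subset_iff.2 hone) fun p hp => ?_
  obtain ⟨t, -, ht⟩ := exists_ge_eq_sqrt_mul_of_near_circle hW hγ.continuous
    (hγ.isIntegralCurveOn _) (fun t _ => by rw [hone]; norm_num) hp 0
  rw [hone, Real.sqrt_one, one_smul] at ht
  exact ⟨t, ht⟩

theorem isCycle_circle (hW : ∀ p, 0 < eval p W) :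
    IsCycle (modifiedP4 W).field {p | p 0 ^ 2 + p 1 ^ 2 = 1} := by
  obtain ⟨γ, h0, hγ, hone, hper⟩ := exists_isIntegralCurve_of_trapped
    (modifiedP4 W).contDiff_field (p := ![1, 0]) (S := {p | p 0 ^ 2 + p 1 ^ 2 = 1})
    ((isBounded_sq_add_sq_le 1).subset fun p hp => le_of_eq hp)
    (fun φ γ hφ h0 hγ => sq_add_sq_eq_one_of_isIntegralCurve hφ hγ (by simp [h0]))
  have hone' : ∀ t, γ t 0 ^ 2 + γ t 1 ^ 2 = 1 := hone
  have hrange := range_eq_circle hW hγ (hone 0)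
  obtain ⟨T, hT, hTγ⟩ := exists_ge_eq_sqrt_mul_of_near_circle hW hγ.continuous
    (hγ.isIntegralCurveOn _) (fun t _ => by rw [hone']; norm_num) (hone 0) 1
  rw [hone', Real.sqrt_one, one_smul] at hTγ
  refine ⟨γ, T, by linarith, hγ, hper T hTγ, ?_, hrange⟩
  have hmem : (![0, 1] : Fin 2 → ℝ) ∈ range γ := by
    rw [hrange]
    simp
  obtain ⟨t, ht⟩ := hmem
  refine ⟨t, fun h => ?_⟩
  rw [ht, h0] at h
  simpa using congrFun h 0

theorem isAttractingLimitCycle_circle (hW : ∀ p, 0 < eval p W) :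
    IsAttractingLimitCycle (modifiedP4 W).field univ {p | p 0 ^ 2 + p 1 ^ 2 = 1} := by
  refine ⟨subset_univ _, isCycle_circle hW, {p | |p 0 ^ 2 + p 1 ^ 2 - 1| < 1 / 2},
    isOpen_lt (by fun_prop) (by fun_prop), fun p hp => ?_, fun p hp => ⟨?_, ?_⟩⟩
  · have hp' : p 0 ^ 2 + p 1 ^ 2 = 1 := hp
    simp [hp']
  · have hp' := (abs_lt.1 (show |p 0 ^ 2 + p 1 ^ 2 - 1| < 1 / 2 from hp.1)).2
    obtain ⟨γ, h0, hγ, -⟩ := exists_isIntegralCurve_of_trapped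
      (modifiedP4 W).contDiff_field (p := p) (isBounded_sq_add_sq_le 9) fun φ γ hφ h0 hγ t => by
        obtain ⟨e, he, h⟩ := exists_pos_sq_add_sq_sub_nine_eq_mul convex_univ (mem_univ _) hφ
          hγ.continuous (hγ.isIntegralCurveOn univ) (mem_univ t)
        rw [h0] at h
        show γ t 0 ^ 2 + γ t 1 ^ 2 ≤ 9
        nlinarith
    exact ⟨γ, h0, hγ.isIntegralCurveOn _⟩
  refine fun γ => omegaLimitSet_eq_of_forall_continuous fun γ hγc h0 hγ => ?_
  have hp' : |γ 0 0 ^ 2 + γ 0 1 ^ 2 - 1| < 1 / 2 := h0 ▸ hp.1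
  have hγ' := hγ.one_smul_field
  have hlt : ∀ t, 0 ≤ t → γ t 0 ^ 2 + γ t 1 ^ 2 ≤ 9 := by
    intro t ht
    obtain ⟨e, he, h⟩ := exists_pos_sq_add_sq_sub_nine_eq_mul (convex_Ici 0) self_mem_Ici
      continuous_const hγc hγ' ht
    nlinarith [(abs_lt.1 hp').2]
  -- (r² - 1)² has logarithmic derivative 4r²(r² - 9). Its sign first confines the curve to the
  -- annulus; there 1/2 ≤ r² ≤ 3/2 makes it at most -15, so decay at rate 1 is ample.
  have hderiv : ∀ t ∈ Ici (0 : ℝ), HasDerivWithinAt (fun t => (γ t 0 ^ 2 + γ t 1 ^ 2 - 1) ^ 2)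
      (4 * (γ t 0 ^ 2 + γ t 1 ^ 2) * (γ t 0 ^ 2 + γ t 1 ^ 2 - 9) *
        (γ t 0 ^ 2 + γ t 1 ^ 2 - 1) ^ 2) (Ici 0) t := fun t ht =>
    (((hasDerivWithinAt_sq_add_sq hγ' ht).sub_const 1).pow 2).congr_deriv (by
      unfold radialRate
      push_cast
      ring)
  have hanti : AntitoneOn (fun t => (γ t 0 ^ 2 + γ t 1 ^ 2 - 1) ^ 2) (Ici 0) := by
    refine antitoneOn_of_hasDerivWithinAt_nonpos (convex_Ici 0) (by fun_prop)
      (fun t ht => (hderiv t (interior_subset ht)).mono interior_subset) fun t ht => ?_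
    have h9 := hlt t (interior_subset ht)
    have h1 : (γ t 0 ^ 2 + γ t 1 ^ 2) * (γ t 0 ^ 2 + γ t 1 ^ 2 - 9) ≤ 0 :=
      mul_nonpos_of_nonneg_of_nonpos (by positivity) (by linarith)
    nlinarith [sq_nonneg (γ t 0 ^ 2 + γ t 1 ^ 2 - 1)]
  have hnear : ∀ t, 0 ≤ t → |γ t 0 ^ 2 + γ t 1 ^ 2 - 1| ≤ 1 / 2 := fun t ht =>
    (sq_le_sq.1 (hanti self_mem_Ici ht ht)).trans hp'.le
  have hlim : Tendsto (fun t => γ t 0 ^ 2 + γ t 1 ^ 2) atTop (𝓝 1) := by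
    have h := tendsto_zero_of_hasDerivWithinAt (by fun_prop) hderiv (c := 1) one_pos
      fun t ht => by
        have := abs_le.1 (hnear t ht)
        nlinarith
    have h2 : Tendsto (fun t => |γ t 0 ^ 2 + γ t 1 ^ 2 - 1|) atTop (𝓝 0) := by
      simpa [Function.comp_def, Real.sqrt_sq_eq_abs] using (Real.continuous_sqrt.tendsto 0).comp h
    simpa using ((tendsto_zero_iff_abs_tendsto_zero _).2 h2).add_const 1
  ext q
  refine ⟨fun hq => ?_, fun hq => ?_⟩
  · have hq' : MapClusterPt q atTop γ := hq
    have h1 := hq'.continuousAt_comp (f := fun p => p 0 ^ 2 + p 1 ^ 2) (by fun_prop)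
    exact eq_of_nhds_neBot (h1.clusterPt.mono hlim).neBot
  -- At late crossing times of the ray through `q` the curve is at r · q, and r → 1.
  · choose t ht htγ using fun n : ℕ => exists_ge_eq_sqrt_mul_of_near_circle hW hγc hγ hnear hq n
    have htop : Tendsto t atTop atTop := tendsto_atTop_mono ht tendsto_natCast_atTop_atTop
    refine MapClusterPt.of_comp htop (Tendsto.mapClusterPt ?_)
    have h1 : Tendsto (fun n => √(γ (t n) 0 ^ 2 + γ (t n) 1 ^ 2) • q) atTop (𝓝 (√1 • q)) :=
      ((Real.continuous_sqrt.tendsto 1).comp (hlim.comp htop)).smul_const q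
    rw [Real.sqrt_one, one_smul] at h1
    exact h1.congr fun n => (htγ n).symm

end UnitCircle

/-! ### The circle r = 3, uniqueness of the cycle, heteroclinic arcs -/

section OuterCircle

variable {W : MvPolynomial (Fin 2) ℝ} {γ : ℝ → Fin 2 → ℝ}

theorem sq_add_sq_eq_nine_of_isIntegralCurve {φ : (Fin 2 → ℝ) → ℝ} (hφ : Continuous φ)
    (hγ : IsIntegralCurve γ (fun _ x => φ x • (modifiedP4 W).field x))
    (h0 : γ 0 0 ^ 2 + γ 0 1 ^ 2 = 9) (t : ℝ) : γ t 0 ^ 2 + γ t 1 ^ 2 = 9 := by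
  obtain ⟨e, -, he⟩ := exists_pos_sq_add_sq_sub_nine_eq_mul convex_univ (mem_univ _) hφ
    hγ.continuous (hγ.isIntegralCurveOn univ) (mem_univ t)
  rw [h0, sub_self, zero_mul] at he
  linarith

theorem hasDerivAt_coord_of_sq_add_sq_eq_nine
    (hγ : IsIntegralCurve γ (fun _ => (modifiedP4 W).field))
    (h9 : ∀ t, γ t 0 ^ 2 + γ t 1 ^ 2 = 9) (t : ℝ) :
    HasDerivAt (fun t => γ t 0) (-((1 - 2 * γ t 0) * eval (γ t) W * γ t 1)) t ∧
    HasDerivAt (fun t => γ t 1) ((1 - 2 * γ t 0) * eval (γ t) W * γ t 0) t := by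
  have hγ' := (hγ.isIntegralCurveOn univ).one_smul_field
  have h1 := (hasDerivWithinAt_coord_zero hγ' (mem_univ t)).hasDerivAt univ_mem
  have h2 := (hasDerivWithinAt_coord_one hγ' (mem_univ t)).hasDerivAt univ_mem
  unfold radialRate angularVelocity at h1 h2
  rw [h9] at h1 h2
  exact ⟨h1.congr_deriv (by ring), h2.congr_deriv (by ring)⟩

/-- On r = 3 the equation for x becomes (x - 1/2)' = 2Wy (x - 1/2), again linear, so both open arcs
are invariant. -/
theorem exists_pos_coord_sub_half_eq_mul
    (hγ : IsIntegralCurve γ (fun _ => (modifiedP4 W).field))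
    (h9 : ∀ t, γ t 0 ^ 2 + γ t 1 ^ 2 = 9) (t : ℝ) :
    ∃ e, 0 < e ∧ γ t 0 - 1 / 2 = (γ 0 0 - 1 / 2) * e := by
  have hc := hγ.continuous
  have hW : Continuous fun p : Fin 2 → ℝ => eval p W := MvPolynomial.continuous_eval W
  refine exists_pos_eq_mul_of_hasDerivWithinAt convex_univ (mem_univ _)
    (f := fun t => γ t 0 - 1 / 2) (a := fun t => 2 * eval (γ t) W * γ t 1)
    (by fun_prop) (fun t _ => ?_) (mem_univ t)
  refine (((hasDerivAt_coord_of_sq_add_sq_eq_nine hγ h9 t).1.sub_const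
    (1 / 2)).hasDerivWithinAt).congr_deriv ?_
  ring

/-- For `σ = ±1`, the point of the circle `x² + y² = 9` at which the stereographic coordinate
`y / (3 + σ x)` is equal to `w`. -/
noncomputable def stereographicPoint (σ w : ℝ) : Fin 2 → ℝ :=
  ![σ * (6 / (1 + w ^ 2) - 3), 6 * w / (1 + w ^ 2)]

theorem continuous_stereographicPoint (σ : ℝ) : Continuous (stereographicPoint σ) := by
  have h : ∀ w : ℝ, 1 + w ^ 2 ≠ 0 := fun w => by positivity
  refine continuous_pi fun i => ?_
  fin_cases i
  · show Continuous fun w : ℝ => σ * (6 / (1 + w ^ 2) - 3)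
    fun_prop (disch := exact h)
  · show Continuous fun w : ℝ => 6 * w / (1 + w ^ 2)
    fun_prop (disch := exact h)

/-- On the circle y² = (3 - σx)(3 + σx). The identity recovers x, and then y, from the stereographic
coordinate. -/
theorem one_add_sq_stereographic {σ x y : ℝ} (hσ : σ ^ 2 = 1) (h9 : x ^ 2 + y ^ 2 = 9)
    (hx : 0 < 3 + σ * x) : 1 + (y / (3 + σ * x)) ^ 2 = 6 / (3 + σ * x) := by
  have := hx.ne'
  field_simp
  linear_combination h9 + x ^ 2 * hσ

theorem stereographicPoint_div {σ : ℝ} {p : Fin 2 → ℝ} (hσ : σ ^ 2 = 1)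
    (h9 : p 0 ^ 2 + p 1 ^ 2 = 9) (hx : 0 < 3 + σ * p 0) :
    stereographicPoint σ (p 1 / (3 + σ * p 0)) = p := by
  have hne := hx.ne'
  ext i
  fin_cases i
  · show σ * (6 / (1 + (p 1 / (3 + σ * p 0)) ^ 2) - 3) = p 0
    rw [one_add_sq_stereographic hσ h9 hx]
    field_simp
    linear_combination p 0 * hσ
  · show 6 * (p 1 / (3 + σ * p 0)) / (1 + (p 1 / (3 + σ * p 0)) ^ 2) = p 1
    rw [one_add_sq_stereographic hσ h9 hx]
    field_simp

theorem three_add_mul_pos {σ x : ℝ} (hσ : σ = 1 ∨ σ = -1) (hx : 0 < σ * (x - 1 / 2)) :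
    0 < 3 + σ * x := by
  rcases hσ with rfl | rfl <;> linarith

/-- The centre of projection (-3σ, 0) lies on the opposite arc, so the coordinate is regular. Its
velocity is 3σθ'/(3 + σx) with θ' = (1 - 2x) W, which is negative on both arcs. -/
theorem hasDerivAt_stereographic (hγ : IsIntegralCurve γ (fun _ => (modifiedP4 W).field))
    (h9 : ∀ t, γ t 0 ^ 2 + γ t 1 ^ 2 = 9) {σ : ℝ} (hσ : σ = 1 ∨ σ = -1)
    (hx : ∀ t, 0 < σ * (γ t 0 - 1 / 2)) (t : ℝ) :
    HasDerivAt (fun t => γ t 1 / (3 + σ * γ t 0))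
      (3 * σ * (1 - 2 * γ t 0) * eval (γ t) W / (3 + σ * γ t 0)) t := by
  obtain ⟨h1, h2⟩ := hasDerivAt_coord_of_sq_add_sq_eq_nine hγ h9 t
  have hne := (three_add_mul_pos hσ (hx t)).ne'
  refine (h2.div ((h1.const_mul σ).const_add 3) hne).congr_deriv ?_
  have hσ2 : σ ^ 2 = 1 := by rcases hσ with rfl | rfl <;> norm_num
  rw [div_eq_div_iff (pow_ne_zero 2 hne) hne]
  linear_combination (1 - 2 * γ t 0) * eval (γ t) W * (3 + σ * γ t 0) *
    (σ * h9 t - 3 * γ t 0 * hσ2)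

theorem stereographic_deriv_neg (hW : ∀ p, 0 < eval p W) {σ : ℝ} (hσ : σ = 1 ∨ σ = -1)
    {p : Fin 2 → ℝ} (hx : 0 < σ * (p 0 - 1 / 2)) :
    3 * σ * (1 - 2 * p 0) * eval p W / (3 + σ * p 0) < 0 := by
  refine div_neg_of_neg_of_pos ?_ (three_add_mul_pos hσ hx)
  have := mul_pos hx (hW p)
  nlinarith

/-- Rolle is applied twice over a period: to r², which puts the cycle on r = 0, 1 or 3, and to the
stereographic coordinate, which rules out the arcs of r = 3. -/
theorem cycle_eq_circle (hW : ∀ p, 0 < eval p W) {Γ : Set (Fin 2 → ℝ)}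
    (hΓ : IsCycle (modifiedP4 W).field Γ) : Γ = {p | p 0 ^ 2 + p 1 ^ 2 = 1} := by
  obtain ⟨β, T, hT, hβ, hβper, hβne, rfl⟩ := hΓ
  have hderiv : ∀ {γ : ℝ → Fin 2 → ℝ}, IsIntegralCurve γ (fun _ => (modifiedP4 W).field) → ∀ t,
      HasDerivAt (fun t => γ t 0 ^ 2 + γ t 1 ^ 2)
        (2 * 1 * radialRate (γ t) * (γ t 0 ^ 2 + γ t 1 ^ 2)) t := fun hγ t =>
    (hasDerivWithinAt_sq_add_sq (hγ.isIntegralCurveOn univ).one_smul_field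
      (mem_univ t)).hasDerivAt univ_mem
  obtain ⟨τ, -, hτ⟩ := exists_hasDerivAt_eq_zero hT
    (fun t _ => (hderiv hβ t).continuousAt.continuousWithinAt)
    (by simpa using congrArg (fun p : Fin 2 → ℝ => p 0 ^ 2 + p 1 ^ 2) (hβper 0).symm)
    (fun t _ => hderiv hβ t)
  -- Time is shifted so that the critical point of r² is at time 0, the base point of the invariance
  -- lemmas.
  set γ : ℝ → Fin 2 → ℝ := β ∘ (· + τ) with hγdef
  have hγ : IsIntegralCurve γ (fun _ => (modifiedP4 W).field) := hβ.comp_add τ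
  have hper : γ T = γ 0 := by
    simp only [hγdef, Function.comp_apply, zero_add]
    rw [add_comm, hβper]
  have hrange : range γ = range β := (Equiv.addRight τ).surjective.range_comp β
  have hne : ¬ ∀ t, γ t = γ 0 := by
    intro h
    obtain ⟨t, ht⟩ := hβne
    have h1 := h (t - τ)
    have h2 := h (0 - τ)
    simp only [hγdef, Function.comp_apply, sub_add_cancel] at h1 h2
    exact ht (h1.trans h2.symm)
  have h0 : γ 0 = β τ := by simp [hγdef]
  rw [← h0] at hτ
  have hγu := (hγ.isIntegralCurveOn univ).one_smul_field
  have hcases : γ 0 0 ^ 2 + γ 0 1 ^ 2 = 0 ∨ γ 0 0 ^ 2 + γ 0 1 ^ 2 = 1 ∨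
      γ 0 0 ^ 2 + γ 0 1 ^ 2 = 9 := by
    unfold radialRate at hτ
    simp only [mul_eq_zero, sub_eq_zero] at hτ
    norm_num at hτ
    tauto
  rw [← hrange]
  rcases hcases with h | h | h
  · refine absurd (fun t => ?_) hne
    have hz : ∀ t, γ t 0 ^ 2 + γ t 1 ^ 2 = 0 := by
      intro t
      obtain ⟨e, -, he⟩ := exists_pos_sq_add_sq_eq_mul convex_univ (mem_univ _) continuous_const
        hγ.continuous hγu (mem_univ t)
      rw [he, h, zero_mul]
    have hz' : ∀ t i, γ t i = 0 := by
      intro t i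
      have := hz t
      fin_cases i
      · show γ t 0 = 0
        nlinarith [sq_nonneg (γ t 0), sq_nonneg (γ t 1)]
      · show γ t 1 = 0
        nlinarith [sq_nonneg (γ t 0), sq_nonneg (γ t 1)]
    exact funext fun i => (hz' t i).trans (hz' 0 i).symm
  · exact range_eq_circle hW hγ h
  · have h9 : ∀ t, γ t 0 ^ 2 + γ t 1 ^ 2 = 9 := sq_add_sq_eq_nine_of_isIntegralCurve (W := W)
      (φ := fun _ => 1) continuous_const (by simpa using hγ) h
    have harc : ∀ σ : ℝ, σ = 1 ∨ σ = -1 → ¬ 0 < σ * (γ 0 0 - 1 / 2) := by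
      intro σ hσ hpos
      have hx : ∀ t, 0 < σ * (γ t 0 - 1 / 2) := by
        intro t
        obtain ⟨e, he, h⟩ := exists_pos_coord_sub_half_eq_mul hγ h9 t
        rw [h, ← mul_assoc]
        exact mul_pos hpos he
      obtain ⟨t, -, ht⟩ := exists_hasDerivAt_eq_zero hT
        (fun t _ => (hasDerivAt_stereographic hγ h9 hσ hx t).continuousAt.continuousWithinAt)
        (by simp only [hper]) (fun t _ => hasDerivAt_stereographic hγ h9 hσ hx t)
      exact (stereographic_deriv_neg hW hσ (hx t)).ne ht
    -- Off both arcs x = 1/2 for all time; there the velocity vanishes and the solution is constant.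
    refine absurd (fun t => ?_) hne
    have h1 := harc 1 (Or.inl rfl)
    have h2 := harc (-1) (Or.inr rfl)
    have hhalf : γ 0 0 - 1 / 2 = 0 := by linarith
    have hhalf' : ∀ t, γ t 0 = 1 / 2 := by
      intro t
      obtain ⟨e, he, h⟩ := exists_pos_coord_sub_half_eq_mul hγ h9 t
      rw [hhalf, zero_mul] at h
      linarith
    have hconst := is_const_of_deriv_eq_zero (f := fun t => γ t 1)
      (fun t => (hasDerivAt_coord_of_sq_add_sq_eq_nine hγ h9 t).2.differentiableAt)
      (fun t => by
        rw [(hasDerivAt_coord_of_sq_add_sq_eq_nine hγ h9 t).2.deriv, hhalf']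
        ring) t 0
    refine funext fun i => ?_
    fin_cases i
    · exact (hhalf' t).trans (hhalf' 0).symm
    · exact hconst

theorem field_pointA : (modifiedP4 W).field pointA = 0 := by
  have h : √35 ^ 2 = 35 := Real.sq_sqrt (by norm_num)
  ext i
  fin_cases i
  · show (modifiedP4 W).field pointA 0 = 0
    rw [field_modifiedP4_zero]
    simp [radialRate, angularVelocity, pointA, div_pow, h]
    norm_num
  · show (modifiedP4 W).field pointA 1 = 0
    rw [field_modifiedP4_one]
    simp [radialRate, angularVelocity, pointA, div_pow, h]
    norm_num

theorem field_pointB : (modifiedP4 W).field pointB = 0 := by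
  have h : √35 ^ 2 = 35 := Real.sq_sqrt (by norm_num)
  ext i
  fin_cases i
  · show (modifiedP4 W).field pointB 0 = 0
    rw [field_modifiedP4_zero]
    simp [radialRate, angularVelocity, pointB, div_pow, h]
    norm_num
  · show (modifiedP4 W).field pointB 1 = 0
    rw [field_modifiedP4_one]
    simp [radialRate, angularVelocity, pointB, div_pow, h]
    norm_num

theorem pointA_ne_pointB : pointA ≠ pointB := by
  intro h
  have h1 := congrFun h 1
  simp [pointA, pointB] at h1
  have : 0 < √35 := by positivity
  linarith

theorem eq_pointA_or_eq_pointB {p : Fin 2 → ℝ} (hx : p 0 = 1 / 2) (h9 : p 0 ^ 2 + p 1 ^ 2 = 9) :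
    (0 ≤ p 1 → p = pointA) ∧ (p 1 ≤ 0 → p = pointB) := by
  have h35 : (2 * p 1) ^ 2 = 35 := by
    rw [hx] at h9
    linarith
  constructor
  · intro h
    have : √35 = 2 * p 1 := by rw [← h35, Real.sqrt_sq (by linarith)]
    ext i
    fin_cases i
    · simpa [pointA] using hx
    · simp [pointA, this]
  · intro h
    have : √35 = -(2 * p 1) := by rw [← h35, Real.sqrt_sq_eq_abs, abs_of_nonpos (by linarith)]
    ext i
    fin_cases i
    · simpa [pointB] using hx
    · simp [pointB, this]

theorem sq_add_sq_stereographicPoint {σ : ℝ} (hσ : σ ^ 2 = 1) (w : ℝ) :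
    stereographicPoint σ w 0 ^ 2 + stereographicPoint σ w 1 ^ 2 = 9 := by
  have h : 1 + w ^ 2 ≠ 0 := by positivity
  show (σ * (6 / (1 + w ^ 2) - 3)) ^ 2 + (6 * w / (1 + w ^ 2)) ^ 2 = 9
  rw [mul_pow, hσ]
  field_simp
  ring

/-- Both open arcs of the circle `x² + y² = 9` cut off by the line `x = 1/2` run from `A` to
`B`. -/
theorem isHeteroclinicOrbit_arc (hW : ∀ p, 0 < eval p W) {σ : ℝ} (hσ : σ = 1 ∨ σ = -1) :
    IsHeteroclinicOrbit (modifiedP4 W).field pointA pointB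
      {p | p 0 ^ 2 + p 1 ^ 2 = 9 ∧ 0 < σ * (p 0 - 1 / 2)} := by
  have hσ2 : σ ^ 2 = 1 := by rcases hσ with rfl | rfl <;> norm_num
  refine ⟨pointA_ne_pointB, field_pointA, field_pointB, ?_⟩
  have hp : (3 * σ) ^ 2 + (0 : ℝ) ^ 2 = 9 := by linear_combination 9 * hσ2
  obtain ⟨γ, h0, hγ, h9, -⟩ := exists_isIntegralCurve_of_trapped
    (modifiedP4 W).contDiff_field (p := ![3 * σ, 0]) (S := {p | p 0 ^ 2 + p 1 ^ 2 = 9})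
    ((isBounded_sq_add_sq_le 9).subset fun p hp => le_of_eq hp)
    (fun φ γ hφ h0 hγ => sq_add_sq_eq_nine_of_isIntegralCurve hφ hγ (by simpa [h0] using hp))
  replace h9 : ∀ t, γ t 0 ^ 2 + γ t 1 ^ 2 = 9 := h9
  have hx : ∀ t, 0 < σ * (γ t 0 - 1 / 2) := by
    intro t
    obtain ⟨e, he, h⟩ := exists_pos_coord_sub_half_eq_mul hγ h9 t
    rw [h, ← mul_assoc]
    refine mul_pos ?_ he
    rw [h0]
    rcases hσ with rfl | rfl <;> norm_num
  set w : ℝ → ℝ := fun t => γ t 1 / (3 + σ * γ t 0) with hw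
  have hwd : ∀ t, HasDerivAt w (3 * σ * (1 - 2 * γ t 0) * eval (γ t) W / (3 + σ * γ t 0)) t :=
    hasDerivAt_stereographic hγ h9 hσ hx
  have hwc : Continuous w := continuous_iff_continuousAt.2 fun t => (hwd t).continuousAt
  have hγw : ∀ t, stereographicPoint σ (w t) = γ t := fun t =>
    stereographicPoint_div hσ2 (h9 t) (three_add_mul_pos hσ (hx t))
  have hanti : StrictAnti w := strictAnti_of_hasDerivAt_neg hwd
    fun t => stereographic_deriv_neg hW hσ (hx t)
  have hbound : ∀ t, |w t| ≤ 2 := by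
    intro t
    have h1 := one_add_sq_stereographic hσ2 (h9 t) (three_add_mul_pos hσ (hx t))
    -- On the arc 3 + σx > 5/2, so this is a crude bound; it only serves to make the monotone
    -- function `w` converge at both ends.
    have h2 : 6 / (3 + σ * γ t 0) ≤ 5 := by
      rw [div_le_iff₀ (three_add_mul_pos hσ (hx t))]
      rcases hσ with rfl | rfl <;> linarith [hx t]
    refine abs_le_of_sq_le_sq ?_ (by norm_num)
    show (γ t 1 / (3 + σ * γ t 0)) ^ 2 ≤ _
    linarith
  have hw0 : w 0 = 0 := by simp [hw, h0]
  have htop : ∃ L, Tendsto w atTop (𝓝 L) :=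
    ⟨_, tendsto_atTop_ciInf hanti.antitone ⟨-2, by
      rintro _ ⟨t, rfl⟩
      exact (abs_le.1 (hbound t)).1⟩⟩
  have hbot : ∃ L, Tendsto w atBot (𝓝 L) :=
    ⟨_, tendsto_atBot_ciSup hanti.antitone ⟨2, by
      rintro _ ⟨t, rfl⟩
      exact (abs_le.1 (hbound t)).2⟩⟩
  obtain ⟨L, hL⟩ := htop
  obtain ⟨L', hL'⟩ := hbot
  have hLneg : L < 0 := by
    have h1 : L ≤ w 1 := hanti.antitone.le_of_tendsto hL 1
    have h2 : w 1 < w 0 := hanti one_pos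
    linarith
  have hLpos : 0 < L' := by
    have h1 : w (-1) ≤ L' := hanti.antitone.ge_of_tendsto hL' (-1)
    have h2 : w 0 < w (-1) := hanti (by norm_num)
    linarith
  have hγL : Tendsto γ atTop (𝓝 (stereographicPoint σ L)) :=
    (((continuous_stereographicPoint σ).tendsto L).comp hL).congr hγw
  have hγL' : Tendsto γ atBot (𝓝 (stereographicPoint σ L')) :=
    (((continuous_stereographicPoint σ).tendsto L').comp hL').congr hγw
  -- The velocity of `w` as a function of the point. It is continuous on the closure of the orbit
  -- and must vanish at both limit points, which forces x = 1/2 there; the signs of `L` and `L'`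
  -- then decide between `B` and `A`.
  set V : (Fin 2 → ℝ) → ℝ := fun p => 3 * σ * (1 - 2 * p 0) * eval p W / (3 + σ * p 0) with hV
  have hge : ∀ p ∈ closure (range γ), 5 / 2 ≤ 3 + σ * p 0 := by
    intro p hp
    refine closure_minimal (s := range γ) (t := {p | 5 / 2 ≤ 3 + σ * p 0}) ?_
      (isClosed_le (by fun_prop) (by fun_prop)) hp
    rintro _ ⟨t, rfl⟩
    show 5 / 2 ≤ 3 + σ * γ t 0
    rcases hσ with rfl | rfl <;> linarith [hx t]
  have hVcont : ∀ p ∈ closure (range γ), ContinuousAt V p := by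
    intro p hp
    have : Continuous fun p : Fin 2 → ℝ => eval p W := MvPolynomial.continuous_eval W
    have hne : 3 + σ * p 0 ≠ 0 := by linarith [hge p hp]
    exact ContinuousAt.div (by fun_prop)
      (by fun_prop : Continuous fun p : Fin 2 → ℝ => 3 + σ * p 0).continuousAt hne
  have hVzero : ∀ p ∈ closure (range γ), V p = 0 → p 0 = 1 / 2 := by
    intro p hp h
    have hne : 3 + σ * p 0 ≠ 0 := by linarith [hge p hp]
    have hσ0 : σ ≠ 0 := by rcases hσ with rfl | rfl <;> norm_num
    have : 1 - 2 * p 0 = 0 := by simpa [hV, hne, (hW p).ne', hσ0] using h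
    linarith
  have hmem : stereographicPoint σ L ∈ closure (range γ) :=
    mem_closure_of_tendsto hγL (Eventually.of_forall fun t => mem_range_self t)
  have hmem' : stereographicPoint σ L' ∈ closure (range γ) :=
    mem_closure_of_tendsto hγL' (Eventually.of_forall fun t => mem_range_self t)
  have hhalf : stereographicPoint σ L 0 = 1 / 2 := hVzero _ hmem <|
    eq_zero_of_tendsto_of_tendsto_deriv hwd hL ((hVcont _ hmem).tendsto.comp hγL)
  have hhalf' : stereographicPoint σ L' 0 = 1 / 2 := hVzero _ hmem' <| by
    -- The backward limit is treated by reversing time.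
    have := eq_zero_of_tendsto_of_tendsto_deriv (f := fun t => w (-t)) (f' := fun t => -V (γ (-t)))
      (fun t => by simpa [Function.comp_def, hV] using (hwd (-t)).scomp t (hasDerivAt_neg t))
      (hL'.comp tendsto_neg_atTop_atBot)
      ((((hVcont _ hmem').tendsto.comp hγL').comp tendsto_neg_atTop_atBot).neg)
    linarith
  have hB : stereographicPoint σ L = pointB :=
    (eq_pointA_or_eq_pointB hhalf (sq_add_sq_stereographicPoint hσ2 L)).2
      (show 6 * L / (1 + L ^ 2) ≤ 0 from div_nonpos_of_nonpos_of_nonneg (by linarith) (by positivity))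
  have hA : stereographicPoint σ L' = pointA :=
    (eq_pointA_or_eq_pointB hhalf' (sq_add_sq_stereographicPoint hσ2 L')).1
      (show 0 ≤ 6 * L' / (1 + L' ^ 2) by positivity)
  refine ⟨γ, hγ, hA ▸ hγL', hB ▸ hγL, Subset.antisymm ?_ ?_⟩
  · rintro _ ⟨t, rfl⟩
    exact ⟨h9 t, hx t⟩
  · rintro p ⟨hp9, hpx⟩
    have hpos := three_add_mul_pos hσ hpx
    have hsq := one_add_sq_stereographic hσ2 hp9 hpos
    -- Since 1 + w² = 6/(3 + σx), points of the open arc have smaller |w| than its endpoints at x =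
    -- 1/2. So their coordinate lies strictly between `L` and `L'`, and the intermediate value
    -- theorem shows it is attained.
    have key : ∀ M, stereographicPoint σ M 0 = 1 / 2 → (p 1 / (3 + σ * p 0)) ^ 2 < M ^ 2 := by
      intro M hM
      have hM' : σ * (6 / (1 + M ^ 2) - 3) = 1 / 2 := hM
      have h1 : 6 / (1 + M ^ 2) = 3 + σ / 2 := by
        linear_combination σ * hM' - (6 / (1 + M ^ 2) - 3) * hσ2
      have h2 : 6 / (1 + M ^ 2) < 3 + σ * p 0 := by linarith
      have h3 : (0 : ℝ) < 1 + M ^ 2 := by positivity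
      rw [div_lt_comm₀ h3 hpos] at h2
      linarith
    have h1 : L < p 1 / (3 + σ * p 0) := by
      have := abs_lt_of_sq_lt_sq' (a := p 1 / (3 + σ * p 0)) (b := -L)
        (by rw [neg_sq]; exact key L hhalf) (by linarith)
      linarith [this.1]
    have h2 : p 1 / (3 + σ * p 0) < L' := (abs_lt_of_sq_lt_sq' (key L' hhalf') hLpos.le).2
    obtain ⟨t₁, ht₁⟩ := (hL.eventually_lt_const h1).exists
    obtain ⟨t₂, ht₂⟩ := (hL'.eventually_const_lt h2).exists
    obtain ⟨t, ht⟩ := mem_range_of_exists_le_of_exists_ge hwc ⟨t₁, ht₁.le⟩ ⟨t₂, ht₂.le⟩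
    refine ⟨t, ?_⟩
    rw [← hγw t, ht]
    exact stereographicPoint_div hσ2 hp9 hpos

end OuterCircle

/-! ### Fixed points and their linearizations -/

section FixedPoints

variable {W : MvPolynomial (Fin 2) ℝ}

theorem fixedPoints_modifiedP4 (hW : ∀ p, 0 < eval p W) :
    {p | (modifiedP4 W).field p = 0} = {pointO, pointA, pointB} := by
  refine Subset.antisymm (fun p hp => ?_) ?_
  · have h0 : (modifiedP4 W).field p 0 = 0 := congrFun hp 0
    have h1 : (modifiedP4 W).field p 1 = 0 := congrFun hp 1
    rw [field_modifiedP4_zero] at h0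
    rw [field_modifiedP4_one] at h1
    rcases eq_or_ne (p 0 ^ 2 + p 1 ^ 2) 0 with hs | hs
    · left
      ext i
      fin_cases i
      · show p 0 = 0
        nlinarith [sq_nonneg (p 0), sq_nonneg (p 1)]
      · show p 1 = 0
        nlinarith [sq_nonneg (p 0), sq_nonneg (p 1)]
    -- The inner products of the field with p and with p turned by a right angle are r² times the
    -- radial and the angular rate, so both rates vanish.
    · have hr : radialRate p = 0 := by
        refine (mul_eq_zero.1 ?_).resolve_right hs
        linear_combination p 0 * h0 + p 1 * h1
      have ha : angularVelocity W p = 0 := by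
        refine (mul_eq_zero.1 ?_).resolve_right hs
        linear_combination p 0 * h1 - p 1 * h0
      have hG := (mul_eq_zero.1 ha).resolve_right (hW p).ne'
      right
      rcases mul_eq_zero.1 hr with h | h
      -- With r = 1, the equation r² - 2x - 8 = 0 would give x = -7/2.
      · exfalso
        nlinarith [sq_nonneg (p 0), sq_nonneg (p 1)]
      · have hx : p 0 = 1 / 2 := by linarith
        have h9 : p 0 ^ 2 + p 1 ^ 2 = 9 := by linarith
        rcases le_total 0 (p 1) with hy | hy
        · exact Or.inl ((eq_pointA_or_eq_pointB hx h9).1 hy)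
        · exact Or.inr ((eq_pointA_or_eq_pointB hx h9).2 hy)
  · rintro p (rfl | rfl | rfl)
    · ext i
      fin_cases i
      · show (modifiedP4 W).field pointO 0 = 0
        simp [field_modifiedP4_zero, pointO]
      · show (modifiedP4 W).field pointO 1 = 0
        simp [field_modifiedP4_one, pointO]
    · exact field_pointA
    · exact field_pointB

theorem PlanarSystem.isEigenvalueAt_iff (F : PlanarSystem) (p : Fin 2 → ℝ) (z : ℂ) :
    F.IsEigenvalueAt p z ↔
      z ^ 2 - ((F.jacobian p).trace : ℂ) * z + ((F.jacobian p).det : ℂ) = 0 := by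
  simp [IsEigenvalueAt, Matrix.charpoly_fin_two, Polynomial.IsRoot, Matrix.trace_fin_two,
    Matrix.det_fin_two]

theorem jacobian_modifiedP4 (p : Fin 2 → ℝ) :
    (modifiedP4 W).jacobian p =
      !![(p 0 ^ 2 + p 1 ^ 2 - 1) * (p 0 ^ 2 + p 1 ^ 2 - 9) +
          2 * p 0 ^ 2 * (2 * (p 0 ^ 2 + p 1 ^ 2) - 10) -
          p 1 * ((2 * p 0 - 2) * eval p W +
            (p 0 ^ 2 + p 1 ^ 2 - 2 * p 0 - 8) * eval p (pderiv 0 W)),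
        2 * p 0 * p 1 * (2 * (p 0 ^ 2 + p 1 ^ 2) - 10) -
          (p 0 ^ 2 + p 1 ^ 2 - 2 * p 0 - 8) * eval p W -
          p 1 * (2 * p 1 * eval p W +
            (p 0 ^ 2 + p 1 ^ 2 - 2 * p 0 - 8) * eval p (pderiv 1 W));
        2 * p 0 * p 1 * (2 * (p 0 ^ 2 + p 1 ^ 2) - 10) +
          (p 0 ^ 2 + p 1 ^ 2 - 2 * p 0 - 8) * eval p W +
          p 0 * ((2 * p 0 - 2) * eval p W +
            (p 0 ^ 2 + p 1 ^ 2 - 2 * p 0 - 8) * eval p (pderiv 0 W)),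
        (p 0 ^ 2 + p 1 ^ 2 - 1) * (p 0 ^ 2 + p 1 ^ 2 - 9) +
          2 * p 1 ^ 2 * (2 * (p 0 ^ 2 + p 1 ^ 2) - 10) +
          p 0 * (2 * p 1 * eval p W +
            (p 0 ^ 2 + p 1 ^ 2 - 2 * p 0 - 8) * eval p (pderiv 1 W))] := by
  have h2 : ∀ i, pderiv i (2 : MvPolynomial (Fin 2) ℝ) = 0 := fun i => by
    rw [show (2 : MvPolynomial (Fin 2) ℝ) = C 2 from (map_ofNat C 2).symm, pderiv_C]
  have h8 : ∀ i, pderiv i (8 : MvPolynomial (Fin 2) ℝ) = 0 := fun i => by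
    rw [show (8 : MvPolynomial (Fin 2) ℝ) = C 8 from (map_ofNat C 8).symm, pderiv_C]
  have h9 : ∀ i, pderiv i (9 : MvPolynomial (Fin 2) ℝ) = 0 := fun i => by
    rw [show (9 : MvPolynomial (Fin 2) ℝ) = C 9 from (map_ofNat C 9).symm, pderiv_C]
  ext i j
  fin_cases i <;> fin_cases j <;>
    simp [PlanarSystem.jacobian, modifiedP4, pderiv_X, h2, h8, h9] <;> ring

theorem isUnstableSpiral_pointO (hW : ∀ p, 0 < eval p W) :
    (modifiedP4 W).IsUnstableSpiral pointO := by
  refine ⟨?_, fun z hz => ?_⟩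
  · have : pointO ∈ {p | (modifiedP4 W).field p = 0} := by
      rw [fixedPoints_modifiedP4 hW]
      exact Or.inl rfl
    exact this
  · set w := eval pointO W with hw
    have hw0 : 0 < w := hW pointO
    rw [PlanarSystem.isEigenvalueAt_iff, jacobian_modifiedP4, ← hw, Matrix.trace_fin_two,
      Matrix.det_fin_two] at hz
    simp [pointO] at hz
    have hre := congrArg Complex.re hz
    have him := congrArg Complex.im hz
    simp [pow_two] at hre him
    -- The characteristic equation is (z - 9)² + 64w² = 0, with roots 9 ± 8wi.
    have him' : z.im * (z.re - 9) = 0 := by linarith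
    rcases mul_eq_zero.1 him' with h | h
    · exfalso
      rw [h] at hre
      nlinarith [sq_nonneg (z.re - 9), mul_pos hw0 hw0]
    · have hre9 : z.re = 9 := by linarith
      refine ⟨by linarith, fun h0 => ?_⟩
      rw [h0, hre9] at hre
      nlinarith [mul_pos hw0 hw0]

/-- The eigenvalues are the coefficients of the linear equations for r² - 9, namely 2r²(r² - 1) =
144, and for x - 1/2 along the circle, namely 2yW. The sign of y separates node from saddle. -/
theorem isEigenvalueAt_iff_of_mem_outer_circle {p : Fin 2 → ℝ} (hx : p 0 = 1 / 2)
    (hy : p 1 ^ 2 = 35 / 4) (z : ℂ) :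
    (modifiedP4 W).IsEigenvalueAt p z ↔ z = (144 : ℝ) ∨ z = (2 * p 1 * eval p W : ℝ) := by
  have htr : ((modifiedP4 W).jacobian p).trace = 144 + 2 * p 1 * eval p W := by
    rw [jacobian_modifiedP4, Matrix.trace_fin_two]
    simp [hx, hy]
    ring
  have hdet : ((modifiedP4 W).jacobian p).det = 144 * (2 * p 1 * eval p W) := by
    rw [jacobian_modifiedP4, Matrix.det_fin_two]
    simp [hx, hy]
    linear_combination (16 * p 1 * eval p W - 64) * hy
  rw [PlanarSystem.isEigenvalueAt_iff, htr, hdet, ← sub_eq_zero (a := z), ← sub_eq_zero (a := z),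
    ← mul_eq_zero]
  push_cast
  constructor <;> intro h <;> linear_combination h

theorem isUnstableNode_pointA (hW : ∀ p, 0 < eval p W) :
    (modifiedP4 W).IsUnstableNode pointA := by
  refine ⟨field_pointA, fun z hz => ?_⟩
  rw [isEigenvalueAt_iff_of_mem_outer_circle (by simp [pointA])
    (by simp [pointA, div_pow]; norm_num)] at hz
  rcases hz with rfl | rfl
  · simp
  · refine ⟨?_, Complex.ofReal_im _⟩
    rw [Complex.ofReal_re]
    have := hW pointA
    have h : (0 : ℝ) < pointA 1 := by simp [pointA]
    positivity

theorem isSaddle_pointB (hW : ∀ p, 0 < eval p W) : (modifiedP4 W).IsSaddle pointB := by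
  have h := fun z => isEigenvalueAt_iff_of_mem_outer_circle (W := W) (p := pointB)
    (by simp [pointB]) (by simp [pointB, div_pow]; norm_num) z
  refine ⟨field_pointB, 2 * pointB 1 * eval pointB W, 144, ?_, by norm_num, (h _).2 (Or.inr rfl),
    (h _).2 (Or.inl rfl)⟩
  refine mul_neg_of_neg_of_pos ?_ (hW _)
  have : (0 : ℝ) < √35 := by positivity
  simp [pointB, neg_div]

end FixedPoints

/-! ### The degree of the system -/

section Degree

namespace MvPolynomial

variable {σ R : Type*} [CommRing R] {p q : MvPolynomial σ R} {a b : ℕ}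

theorem totalDegree_mul_le_add (hp : p.totalDegree ≤ a) (hq : q.totalDegree ≤ b) :
    (p * q).totalDegree ≤ a + b :=
  (totalDegree_mul p q).trans (add_le_add hp hq)

theorem totalDegree_add_le_of_le (hp : p.totalDegree ≤ a) (hq : q.totalDegree ≤ a) :
    (p + q).totalDegree ≤ a :=
  (totalDegree_add p q).trans (max_le hp hq)

theorem totalDegree_sub_le_of_le (hp : p.totalDegree ≤ a) (hq : q.totalDegree ≤ a) :
    (p - q).totalDegree ≤ a :=
  (totalDegree_sub p q).trans (max_le hp hq)

theorem totalDegree_ofNat (n : ℕ) [n.AtLeastTwo] :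
    (ofNat(n) : MvPolynomial σ R).totalDegree = 0 := by
  rw [show (ofNat(n) : MvPolynomial σ R) = C (ofNat(n)) from (map_ofNat C n).symm, totalDegree_C]

theorem isHomogeneous_sq_add_sq : (X 0 ^ 2 + X 1 ^ 2 : MvPolynomial (Fin 2) ℝ).IsHomogeneous 2 :=
  (isHomogeneous_X_pow 0 2).add (isHomogeneous_X_pow 1 2)

theorem sq_add_sq_ne_zero : (X 0 ^ 2 + X 1 ^ 2 : MvPolynomial (Fin 2) ℝ) ≠ 0 := by
  intro h
  have := congrArg (eval ![1, 0]) h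
  simp at this

theorem totalDegree_sq_add_sq :
    (X 0 ^ 2 + X 1 ^ 2 : MvPolynomial (Fin 2) ℝ).totalDegree = 2 :=
  isHomogeneous_sq_add_sq.totalDegree sq_add_sq_ne_zero

end MvPolynomial

/-- The upper bound uses N ≥ 2 to absorb the quintic radial terms. For the lower bound, xQ - yP =
r²(r² - 2x - 8) W has degree exactly N + 4, so no cancellation of leading terms has to be examined.
-/
theorem degree_modifiedP4 {W : MvPolynomial (Fin 2) ℝ} (hW : IsAdmissibleFactor W) :
    (modifiedP4 W).degree = W.totalDegree + 3 := by
  have hN := hW.2.1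
  have hX : ∀ i, (X i : MvPolynomial (Fin 2) ℝ).totalDegree ≤ 1 := fun i => (totalDegree_X i).le
  have hR : (X 0 ^ 2 + X 1 ^ 2 : MvPolynomial (Fin 2) ℝ).totalDegree ≤ 2 :=
    totalDegree_sq_add_sq.le
  have hlow : (2 * X 0 + 8 : MvPolynomial (Fin 2) ℝ).totalDegree ≤ 1 := by
    refine totalDegree_add_le_of_le ?_ (by rw [totalDegree_ofNat]; omega)
    have := totalDegree_mul_le_add (totalDegree_ofNat (σ := Fin 2) (R := ℝ) 2).le (hX 0)
    omega
  have hG : (X 0 ^ 2 + X 1 ^ 2 - 2 * X 0 - 8 : MvPolynomial (Fin 2) ℝ).totalDegree = 2 := by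
    rw [show (X 0 ^ 2 + X 1 ^ 2 - 2 * X 0 - 8 : MvPolynomial (Fin 2) ℝ) =
      X 0 ^ 2 + X 1 ^ 2 + -(2 * X 0 + 8) by ring, totalDegree_add_eq_left_of_totalDegree_lt,
      totalDegree_sq_add_sq]
    rw [totalDegree_neg, totalDegree_sq_add_sq]
    omega
  have h1 : ∀ i, (X i * (X 0 ^ 2 + X 1 ^ 2 - 1) * (X 0 ^ 2 + X 1 ^ 2 - 9) :
      MvPolynomial (Fin 2) ℝ).totalDegree ≤ W.totalDegree + 3 := by
    intro i
    refine (totalDegree_mul_le_add (totalDegree_mul_le_add (hX i)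
      (totalDegree_sub_le_of_le hR ?_)) (totalDegree_sub_le_of_le hR ?_)).trans ?_
    · rw [totalDegree_one]; omega
    · rw [totalDegree_ofNat]; omega
    · omega
  have h2 : ∀ i, (X i * (X 0 ^ 2 + X 1 ^ 2 - 2 * X 0 - 8) * W).totalDegree ≤
      W.totalDegree + 3 := by
    intro i
    refine (totalDegree_mul_le_add (totalDegree_mul_le_add (hX i) hG.le) le_rfl).trans ?_
    omega
  refine le_antisymm (max_le (totalDegree_sub_le_of_le (h1 0) (h2 1))
    (totalDegree_add_le_of_le (h1 1) (h2 0))) ?_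
  have hW0 : W ≠ 0 := by
    rintro rfl
    simp at hN
  have hG0 : (X 0 ^ 2 + X 1 ^ 2 - 2 * X 0 - 8 : MvPolynomial (Fin 2) ℝ) ≠ 0 := by
    intro h
    rw [h] at hG
    simp at hG
  have hcross : (X 0 * modifiedP4 W 1 - X 1 * modifiedP4 W 0).totalDegree =
      W.totalDegree + 4 := by
    rw [show X 0 * modifiedP4 W 1 - X 1 * modifiedP4 W 0 =
      (X 0 ^ 2 + X 1 ^ 2) * (X 0 ^ 2 + X 1 ^ 2 - 2 * X 0 - 8) * W by
        simp [modifiedP4]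
        ring,
      totalDegree_mul_of_isDomain (mul_ne_zero sq_add_sq_ne_zero hG0) hW0,
      totalDegree_mul_of_isDomain sq_add_sq_ne_zero hG0, totalDegree_sq_add_sq, hG]
    ring
  have hle : (X 0 * modifiedP4 W 1 - X 1 * modifiedP4 W 0).totalDegree ≤
      1 + (modifiedP4 W).degree :=
    totalDegree_sub_le_of_le (totalDegree_mul_le_add (hX 0) (le_max_right _ _))
      (totalDegree_mul_le_add (hX 1) (le_max_left _ _))
  omega

end Degree

/-! ### The extension to the Poincaré sphere -/

section Homogenization

theorem MvPolynomial.IsHomogeneous.eval_smul {σ : Type*} [Fintype σ] {R : Type*} [CommSemiring R]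
    {q : MvPolynomial σ R} {k : ℕ} (hq : q.IsHomogeneous k) (t : R) (v : σ → R) :
    eval (t • v) q = t ^ k * eval v q := by
  rw [eval_eq', eval_eq', Finset.mul_sum]
  refine Finset.sum_congr rfl fun d hd => ?_
  have hdeg : ∑ i, d i = k := by
    have := hq (mem_support_iff.1 hd)
    rwa [show (1 : σ → ℕ) = fun _ => 1 from rfl, ← Finsupp.degree_eq_weight_one,
      Finsupp.degree_eq_sum] at this
  simp only [Pi.smul_apply, smul_eq_mul, mul_pow, Finset.prod_mul_distrib, Finset.prod_pow_eq_pow_sum,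
    hdeg]
  ring

namespace PlanarSystem

theorem contDiff_homogenized (m : ℕ) (R : MvPolynomial (Fin 2) ℝ) {n : WithTop ℕ∞} :
    ContDiff ℝ n (homogenized m R) := by
  unfold homogenized
  refine ContDiff.sum fun k _ => ContDiff.mul (by fun_prop) ?_
  refine (contDiff_eval _).comp (contDiff_pi.2 fun i => ?_)
  fin_cases i
  · exact contDiff_apply ℝ ℝ 0
  · exact contDiff_apply ℝ ℝ 1

theorem contDiff_poincareField (F : PlanarSystem) {n : WithTop ℕ∞} :
    ContDiff ℝ n F.poincareField := by
  have h0 := contDiff_homogenized F.degree (F 0) (n := n)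
  have h1 := contDiff_homogenized F.degree (F 1) (n := n)
  unfold poincareField
  refine contDiff_pi.2 fun i => ?_
  fin_cases i <;> dsimp <;> fun_prop

theorem homogenized_of_ne_zero {m : ℕ} {R : MvPolynomial (Fin 2) ℝ} (hR : R.totalDegree ≤ m)
    {u : Fin 3 → ℝ} (hu : u 2 ≠ 0) :
    homogenized m R u = u 2 ^ m * eval ![u 0 / u 2, u 1 / u 2] R := by
  have hsum : R = ∑ k ∈ Finset.range (m + 1), homogeneousComponent k R := by
    conv_lhs => rw [← sum_homogeneousComponent R]
    refine Finset.sum_subset (Finset.range_mono (by omega)) fun k _ hk => ?_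
    exact homogeneousComponent_eq_zero k R (by simpa using hk)
  conv_rhs => rw [hsum, map_sum, Finset.mul_sum]
  refine Finset.sum_congr rfl fun k hk => ?_
  have hk' : k ≤ m := by simpa [Nat.lt_succ_iff] using hk
  have hv : (![u 0, u 1] : Fin 2 → ℝ) = u 2 • ![u 0 / u 2, u 1 / u 2] := by
    ext i
    fin_cases i
    · simp [mul_div_cancel₀ _ hu]
    · simp [mul_div_cancel₀ _ hu]
  rw [hv, (homogeneousComponent_isHomogeneous k R).eval_smul, ← mul_assoc, ← pow_add,
    Nat.sub_add_cancel hk']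

theorem homogenized_of_eq_zero (m : ℕ) (R : MvPolynomial (Fin 2) ℝ) {u : Fin 3 → ℝ}
    (hu : u 2 = 0) : homogenized m R u = eval ![u 0, u 1] (homogeneousComponent m R) := by
  unfold homogenized
  rw [Finset.sum_eq_single m]
  · simp
  · intro k hk hkm
    have : m - k ≠ 0 := by
      have := Finset.mem_range.1 hk
      omega
    rw [hu, zero_pow this, zero_mul]
  · simp

end PlanarSystem

open PlanarSystem

variable {W : MvPolynomial (Fin 2) ℝ}

/-- Positivity of W handles Z > 0, and definiteness of its top-degree part handles Z = 0. -/
theorem homogenized_pos (hW : IsAdmissibleFactor W) {u : Fin 3 → ℝ} (hu : 0 ≤ u 2)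
    (hu' : 0 < u 0 ^ 2 + u 1 ^ 2) : 0 < homogenized W.totalDegree W u := by
  rcases hu.eq_or_lt with h | h
  · rw [homogenized_of_eq_zero _ _ h.symm]
    refine hW.2.2 _ fun h0 => ?_
    have h1 := congrFun h0 0
    have h2 := congrFun h0 1
    simp at h1 h2
    simp [h1, h2] at hu'
  · rw [homogenized_of_ne_zero le_rfl h.ne']
    exact mul_pos (pow_pos h _) (hW.1 _)

/-- The homogenization of the angular velocity of `modifiedP4 W`. -/
noncomputable def sphereAngularVelocity (W : MvPolynomial (Fin 2) ℝ) (u : Fin 3 → ℝ) : ℝ :=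
  (u 0 ^ 2 + u 1 ^ 2 - 2 * u 0 * u 2 - 8 * u 2 ^ 2) * homogenized W.totalDegree W u

/-- The homogenization of the radial rate of `modifiedP4 W`, in the degree of the angular
velocity. -/
noncomputable def sphereRadialRate (W : MvPolynomial (Fin 2) ℝ) (u : Fin 3 → ℝ) : ℝ :=
  u 2 ^ (W.totalDegree - 2) * (u 0 ^ 2 + u 1 ^ 2 - u 2 ^ 2) * (u 0 ^ 2 + u 1 ^ 2 - 9 * u 2 ^ 2)

@[fun_prop]
theorem continuous_sphereAngularVelocity : Continuous (sphereAngularVelocity W) := by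
  have := (contDiff_homogenized W.totalDegree W (n := 0)).continuous
  unfold sphereAngularVelocity
  fun_prop

@[fun_prop]
theorem continuous_sphereRadialRate : Continuous (sphereRadialRate W) := by
  unfold sphereRadialRate
  fun_prop

theorem homogenized_modifiedP4 (hW : IsAdmissibleFactor W) (u : Fin 3 → ℝ) :
    homogenized (modifiedP4 W).degree (modifiedP4 W 0) u =
      sphereRadialRate W u * u 0 - sphereAngularVelocity W u * u 1 ∧
    homogenized (modifiedP4 W).degree (modifiedP4 W 1) u =
      sphereRadialRate W u * u 1 + sphereAngularVelocity W u * u 0 := by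
  -- Where Z ≠ 0 the formulas follow by substituting (X/Z, Y/Z); density and continuity carry them
  -- to the equator.
  have hdense : Dense {u : Fin 3 → ℝ | u 2 ≠ 0} :=
    (dense_compl_singleton (0 : ℝ)).preimage (isOpenMap_eval 2)
  have hc0 := (contDiff_homogenized (modifiedP4 W).degree (modifiedP4 W 0) (n := 0)).continuous
  have hc1 := (contDiff_homogenized (modifiedP4 W).degree (modifiedP4 W 1) (n := 0)).continuous
  obtain ⟨n, hn⟩ : ∃ n, W.totalDegree = n + 2 := ⟨W.totalDegree - 2, by have := hW.2.1; omega⟩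
  have key : ∀ u : Fin 3 → ℝ, u 2 ≠ 0 →
      eval ![u 0 / u 2, u 1 / u 2] W = homogenized W.totalDegree W u / u 2 ^ (n + 2) := by
    intro u hu
    rw [homogenized_of_ne_zero le_rfl hu, hn, mul_div_cancel_left₀ _ (pow_ne_zero _ hu)]
  constructor
  · have hc : Continuous fun u : Fin 3 → ℝ =>
        sphereRadialRate W u * u 0 - sphereAngularVelocity W u * u 1 := by fun_prop
    refine congrFun (hc0.ext_on hdense hc fun u hu => ?_) u
    have hu' : u 2 ≠ 0 := hu
    have hf := field_modifiedP4_zero W ![u 0 / u 2, u 1 / u 2]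
    rw [PlanarSystem.field] at hf
    rw [homogenized_of_ne_zero (show (modifiedP4 W 0).totalDegree ≤ (modifiedP4 W).degree from
      le_max_left _ _) hu', hf, degree_modifiedP4 hW]
    simp only [radialRate, angularVelocity, sphereRadialRate, sphereAngularVelocity, key u hu', hn,
      Nat.add_sub_cancel, Matrix.cons_val_zero, Matrix.cons_val_one]
    field_simp
    ring
  · have hc : Continuous fun u : Fin 3 → ℝ =>
        sphereRadialRate W u * u 1 + sphereAngularVelocity W u * u 0 := by fun_prop
    refine congrFun (hc1.ext_on hdense hc fun u hu => ?_) u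
    have hu' : u 2 ≠ 0 := hu
    have hf := field_modifiedP4_one W ![u 0 / u 2, u 1 / u 2]
    rw [PlanarSystem.field] at hf
    rw [homogenized_of_ne_zero (show (modifiedP4 W 1).totalDegree ≤ (modifiedP4 W).degree from
      le_max_right _ _) hu', hf, degree_modifiedP4 hW]
    simp only [radialRate, angularVelocity, sphereRadialRate, sphereAngularVelocity, key u hu', hn,
      Nat.add_sub_cancel, Matrix.cons_val_zero, Matrix.cons_val_one]
    field_simp
    ring

/-- The rotational part is orthogonal to (X, Y), so X P* + Y Q* is just (X² + Y²) times the radial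
rate. The field keeps the rotation-plus-scaling shape in (X, Y). -/
theorem poincareField_modifiedP4 (hW : IsAdmissibleFactor W) (u : Fin 3 → ℝ) :
    (modifiedP4 W).poincareField u =
      ![(1 - (u 0 ^ 2 + u 1 ^ 2)) * sphereRadialRate W u * u 0 - sphereAngularVelocity W u * u 1,
        (1 - (u 0 ^ 2 + u 1 ^ 2)) * sphereRadialRate W u * u 1 + sphereAngularVelocity W u * u 0,
        -((u 0 ^ 2 + u 1 ^ 2) * sphereRadialRate W u) * u 2] := by
  obtain ⟨h0, h1⟩ := homogenized_modifiedP4 hW u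
  unfold PlanarSystem.poincareField
  ext i
  fin_cases i <;> simp [h0, h1] <;> ring

end Homogenization

/-! ### Invariance of the sphere and of the sign of Z -/

section SphereCurves

variable {W : MvPolynomial (Fin 2) ℝ} {φ : (Fin 3 → ℝ) → ℝ} {γ : ℝ → Fin 3 → ℝ} {s : Set ℝ}

theorem hasDerivWithinAt_sphere_coord (hW : IsAdmissibleFactor W)
    (hγ : IsIntegralCurveOn γ (fun _ u => φ u • (modifiedP4 W).poincareField u) s)
    {t : ℝ} (ht : t ∈ s) :
    HasDerivWithinAt (fun t => γ t 0)
      (φ (γ t) * ((1 - (γ t 0 ^ 2 + γ t 1 ^ 2)) * sphereRadialRate W (γ t)) * γ t 0 -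
        φ (γ t) * sphereAngularVelocity W (γ t) * γ t 1) s t ∧
    HasDerivWithinAt (fun t => γ t 1)
      (φ (γ t) * ((1 - (γ t 0 ^ 2 + γ t 1 ^ 2)) * sphereRadialRate W (γ t)) * γ t 1 +
        φ (γ t) * sphereAngularVelocity W (γ t) * γ t 0) s t ∧
    HasDerivWithinAt (fun t => γ t 2)
      (-(φ (γ t) * (γ t 0 ^ 2 + γ t 1 ^ 2) * sphereRadialRate W (γ t)) * γ t 2) s t := by
  have h := hasDerivWithinAt_pi.1 (hγ t ht)
  beta_reduce at h
  rw [poincareField_modifiedP4 hW] at h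
  refine ⟨(h 0).congr_deriv ?_, (h 1).congr_deriv ?_, (h 2).congr_deriv ?_⟩ <;> simp <;> ring

theorem sphere_invariant (hW : IsAdmissibleFactor W) (hs : Convex ℝ s) (hs0 : (0 : ℝ) ∈ s)
    (hφ : Continuous φ) (hγc : Continuous γ)
    (hγ : IsIntegralCurveOn γ (fun _ u => φ u • (modifiedP4 W).poincareField u) s)
    (h0 : γ 0 0 ^ 2 + γ 0 1 ^ 2 + γ 0 2 ^ 2 = 1) {t : ℝ} (ht : t ∈ s) :
    γ t 0 ^ 2 + γ t 1 ^ 2 + γ t 2 ^ 2 = 1 := by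
  obtain ⟨e, -, he⟩ := exists_pos_eq_mul_of_hasDerivWithinAt hs hs0
    (f := fun t => γ t 0 ^ 2 + γ t 1 ^ 2 + γ t 2 ^ 2 - 1)
    (a := fun t => -(2 * φ (γ t) * (γ t 0 ^ 2 + γ t 1 ^ 2) * sphereRadialRate W (γ t)))
    (by fun_prop) (fun t ht => by
      obtain ⟨h1, h2, h3⟩ := hasDerivWithinAt_sphere_coord hW hγ ht
      refine ((((h1.pow 2).add (h2.pow 2)).add (h3.pow 2)).sub_const 1).congr_deriv ?_
      push_cast
      ring) ht
  rw [h0, sub_self, zero_mul] at he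
  linarith

theorem exists_pos_height_eq_mul (hW : IsAdmissibleFactor W) (hs : Convex ℝ s)
    (hs0 : (0 : ℝ) ∈ s) (hφ : Continuous φ) (hγc : Continuous γ)
    (hγ : IsIntegralCurveOn γ (fun _ u => φ u • (modifiedP4 W).poincareField u) s)
    {t : ℝ} (ht : t ∈ s) : ∃ e, 0 < e ∧ γ t 2 = γ 0 2 * e :=
  exists_pos_eq_mul_of_hasDerivWithinAt hs hs0 (f := fun t => γ t 2)
    (a := fun t => -(φ (γ t) * (γ t 0 ^ 2 + γ t 1 ^ 2) * sphereRadialRate W (γ t)))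
    (by fun_prop) (fun _ ht => (hasDerivWithinAt_sphere_coord hW hγ ht).2.2) ht

end SphereCurves

theorem isBounded_sphere :
    Bornology.IsBounded {u : Fin 3 → ℝ | u 0 ^ 2 + u 1 ^ 2 + u 2 ^ 2 = 1} := by
  refine (Metric.isBounded_closedBall (x := (0 : Fin 3 → ℝ)) (r := 1)).subset fun u hu => ?_
  have hu' : u 0 ^ 2 + u 1 ^ 2 + u 2 ^ 2 = 1 := hu
  rw [mem_closedBall_zero_iff, pi_norm_le_iff_of_nonneg zero_le_one]
  intro i
  rw [Real.norm_eq_abs, ← sq_le_one_iff_abs_le_one]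
  fin_cases i
  · show u 0 ^ 2 ≤ 1
    nlinarith [sq_nonneg (u 1), sq_nonneg (u 2)]
  · show u 1 ^ 2 ≤ 1
    nlinarith [sq_nonneg (u 0), sq_nonneg (u 2)]
  · show u 2 ^ 2 ≤ 1
    nlinarith [sq_nonneg (u 0), sq_nonneg (u 1)]

/-! ### The limit cycle at infinity -/

section Equator

variable {W : MvPolynomial (Fin 2) ℝ}

theorem exists_le_sphereAngularVelocity (hW : IsAdmissibleFactor W) :
    ∃ c, 0 < c ∧ ∀ u ∈ upperHemisphere, u 2 ≤ 1 / 10 → c ≤ sphereAngularVelocity W u := by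
  have hclosed : IsClosed {u : Fin 3 → ℝ |
      u 0 ^ 2 + u 1 ^ 2 + u 2 ^ 2 = 1 ∧ 0 ≤ u 2 ∧ u 2 ≤ 1 / 10} := by
    have h1 : IsClosed {u : Fin 3 → ℝ | u 0 ^ 2 + u 1 ^ 2 + u 2 ^ 2 = 1} :=
      isClosed_eq (by fun_prop) (by fun_prop)
    have h2 : IsClosed {u : Fin 3 → ℝ | 0 ≤ u 2} := isClosed_le (by fun_prop) (by fun_prop)
    have h3 : IsClosed {u : Fin 3 → ℝ | u 2 ≤ 1 / 10} := isClosed_le (by fun_prop) (by fun_prop)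
    exact h1.inter (h2.inter h3)
  have hK : IsCompact {u : Fin 3 → ℝ |
      u 0 ^ 2 + u 1 ^ 2 + u 2 ^ 2 = 1 ∧ 0 ≤ u 2 ∧ u 2 ≤ 1 / 10} :=
    Metric.isCompact_of_isClosed_isBounded hclosed (isBounded_sphere.subset fun u hu => hu.1)
  obtain ⟨c, hc, h⟩ := hK.exists_forall_le' (f := sphereAngularVelocity W)
    (by fun_prop) (a := 0) (fun u hu => by
      obtain ⟨h1, h2, h3⟩ := hu
      have hz : u 2 ^ 2 ≤ 1 / 100 := by nlinarith
      -- For Z ≤ 1/10 one has X² + Y² ≥ 99/100, whereas 2XZ ≤ 1/5 and 8Z² ≤ 2/25.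
      refine mul_pos ?_ (homogenized_pos hW h2 (by linarith))
      have : (u 0 + u 2) ^ 2 ≥ 0 := sq_nonneg _
      nlinarith [sq_nonneg (u 0 - u 2), sq_nonneg (u 1), sq_nonneg (u 0 - 5 * u 2)])
  exact ⟨c, hc, fun u hu hu' => h u ⟨hu.1, hu.2, hu'⟩⟩

/-- Trajectories that stay near the equator go around it forever. -/
theorem exists_ge_eq_sqrt_mul_of_near_equator (hW : IsAdmissibleFactor W) {γ : ℝ → Fin 3 → ℝ}
    (hγc : Continuous γ) (hγ : IsIntegralCurveOn γ (fun _ => (modifiedP4 W).poincareField) (Ici 0))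
    (hnear : ∀ t, 0 ≤ t → γ t ∈ upperHemisphere ∧ γ t 2 ≤ 1 / 10) {p : Fin 3 → ℝ}
    (hp : p ∈ equator) (M : ℝ) :
    ∃ t, M ≤ t ∧ γ t = ![√(γ t 0 ^ 2 + γ t 1 ^ 2) * p 0, √(γ t 0 ^ 2 + γ t 1 ^ 2) * p 1, γ t 2] := by
  obtain ⟨c, hc, h⟩ := exists_le_sphereAngularVelocity hW
  have hγ' := hγ.one_smul_field
  obtain ⟨t, -, htM, hx, hy⟩ := exists_ge_eq_sqrt_mul (x := fun t => γ t 0) (y := fun t => γ t 1)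
    (a := fun t => 1 * ((1 - (γ t 0 ^ 2 + γ t 1 ^ 2)) * sphereRadialRate W (γ t)))
    (b := fun t => 1 * sphereAngularVelocity W (γ t)) (by fun_prop) (by fun_prop)
    (fun t ht => (hasDerivWithinAt_sphere_coord hW hγ' ht).1)
    (fun t ht => (hasDerivWithinAt_sphere_coord hW hγ' ht).2.1)
    hc (Or.inl fun t ht => by simpa using h _ (hnear t ht).1 (hnear t ht).2) hp.1 M
  refine ⟨t, htM, funext fun i => ?_⟩
  fin_cases i
  · exact hx
  · exact hy
  · rfl

theorem mem_equator_of_isIntegralCurve (hW : IsAdmissibleFactor W) {φ : (Fin 3 → ℝ) → ℝ}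
    (hφ : Continuous φ) {γ : ℝ → Fin 3 → ℝ}
    (hγ : IsIntegralCurve γ (fun _ u => φ u • (modifiedP4 W).poincareField u))
    (h0 : γ 0 ∈ equator) (t : ℝ) : γ t ∈ equator := by
  have hs := sphere_invariant hW convex_univ (mem_univ _) hφ hγ.continuous
    (hγ.isIntegralCurveOn univ) (by rw [h0.2, h0.1]; norm_num) (mem_univ t)
  obtain ⟨e, -, he⟩ := exists_pos_height_eq_mul hW convex_univ (mem_univ _) hφ hγ.continuous
    (hγ.isIntegralCurveOn univ) (mem_univ t)
  rw [h0.2, zero_mul] at he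
  rw [he] at hs
  exact ⟨by linarith, he⟩

theorem equator_subset_upperHemisphere : equator ⊆ upperHemisphere := fun u hu =>
  ⟨by rw [hu.1, hu.2]; norm_num, hu.2.ge⟩

theorem isCycle_equator (hW : IsAdmissibleFactor W) :
    IsCycle (modifiedP4 W).poincareField equator := by
  have hp : (![1, 0, 0] : Fin 3 → ℝ) ∈ equator := by simp [equator]
  obtain ⟨γ, h0, hγ, hmem, hper⟩ := exists_isIntegralCurve_of_trapped
    (modifiedP4 W).contDiff_poincareField (p := ![1, 0, 0])
    (isBounded_sphere.subset fun u hu => (equator_subset_upperHemisphere hu).1)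
    (fun φ γ hφ h0 hγ => mem_equator_of_isIntegralCurve hW hφ hγ (h0 ▸ hp))
  have hnear : ∀ t, 0 ≤ t → γ t ∈ upperHemisphere ∧ γ t 2 ≤ 1 / 10 := fun t _ =>
    ⟨equator_subset_upperHemisphere (hmem t), by rw [(hmem t).2]; norm_num⟩
  have hsweep : ∀ p ∈ equator, ∃ t, 1 ≤ t ∧ γ t = p := by
    intro p hp
    obtain ⟨t, ht, htp⟩ := exists_ge_eq_sqrt_mul_of_near_equator hW hγ.continuous
      (hγ.isIntegralCurveOn _) hnear hp 1
    refine ⟨t, ht, ?_⟩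
    rw [htp, (hmem t).1, (hmem t).2, Real.sqrt_one, one_mul, one_mul]
    ext i
    fin_cases i
    · rfl
    · rfl
    · exact hp.2.symm
  obtain ⟨T, hT, hTγ⟩ := hsweep _ (hmem 0)
  refine ⟨γ, T, by linarith, hγ, hper T hTγ, ?_, Subset.antisymm (range_subset_iff.2 hmem)
    fun p hp => ?_⟩
  · obtain ⟨t, -, ht⟩ := hsweep ![0, 1, 0] (by simp [equator])
    refine ⟨t, fun h => ?_⟩
    rw [ht, h0] at h
    simpa using congrFun h 0
  · obtain ⟨t, -, ht⟩ := hsweep p hp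
    exact ⟨t, ht⟩

theorem half_le_radial_factor {r z : ℝ} (hr : r + z ^ 2 = 1) (hz : z ^ 2 ≤ 1 / 100) :
    1 / 2 ≤ r * (r - z ^ 2) * (r - 9 * z ^ 2) := by
  have h1 : (9 / 10 : ℝ) ≤ r := by linarith
  have h2 : (9 / 10 : ℝ) ≤ r - z ^ 2 := by linarith
  have h3 : (9 / 10 : ℝ) ≤ r - 9 * z ^ 2 := by linarith
  calc (1 / 2 : ℝ) ≤ 9 / 10 * (9 / 10) * (9 / 10) := by norm_num
    _ ≤ _ := by gcongr

/-- Outside the image of the circle r = 3 the radial rate is nonnegative, so Z does not increase. -/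
theorem height_bounds (hW : IsAdmissibleFactor W) {γ : ℝ → Fin 3 → ℝ} (hγc : Continuous γ)
    (hγ : IsIntegralCurveOn γ (fun _ => (modifiedP4 W).poincareField) (Ici 0))
    (h0 : γ 0 ∈ upperHemisphere) (hz : γ 0 2 < 1 / 10) :
    (∀ t, 0 ≤ t → γ t ∈ upperHemisphere ∧ γ t 2 ≤ 1 / 10) ∧
      Tendsto (fun t => γ t 2) atTop (𝓝 0) := by
  have hγ' := hγ.one_smul_field
  have hderiv := fun (t : ℝ) (ht : t ∈ Ici (0 : ℝ)) =>
    (hasDerivWithinAt_sphere_coord hW hγ' ht).2.2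
  have hsph : ∀ t, 0 ≤ t → γ t 0 ^ 2 + γ t 1 ^ 2 + γ t 2 ^ 2 = 1 := fun t ht =>
    sphere_invariant hW (convex_Ici 0) self_mem_Ici continuous_const hγc hγ' h0.1 ht
  have hnonneg : ∀ t, 0 ≤ t → 0 ≤ γ t 2 := by
    intro t ht
    obtain ⟨e, he, h⟩ := exists_pos_height_eq_mul hW (convex_Ici 0) self_mem_Ici continuous_const
      hγc hγ' ht
    rw [h]
    exact mul_nonneg h0.2 he.le
  -- On the sphere 1 - 10Z² = X² + Y² - 9Z², the homogenization of r² - 9, so it satisfies a linear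
  -- equation and stays positive.
  have hbarrier : ∀ t, 0 ≤ t → 0 < 1 - 10 * γ t 2 ^ 2 := by
    intro t ht
    obtain ⟨e, he, h⟩ := exists_pos_eq_mul_of_hasDerivWithinAt (convex_Ici 0) self_mem_Ici
      (f := fun t => 1 - 10 * γ t 2 ^ 2)
      (a := fun t => 20 * (γ t 0 ^ 2 + γ t 1 ^ 2) * γ t 2 ^ 2 *
        (γ t 2 ^ (W.totalDegree - 2) * (γ t 0 ^ 2 + γ t 1 ^ 2 - γ t 2 ^ 2)))
      (by fun_prop) (fun t ht => by
        refine (((hderiv t ht).pow 2).const_mul 10 |>.const_sub 1).congr_deriv ?_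
        have h1 : 1 - 10 * γ t 2 ^ 2 = γ t 0 ^ 2 + γ t 1 ^ 2 - 9 * γ t 2 ^ 2 := by
          linarith [hsph t ht]
        rw [h1]
        unfold sphereRadialRate
        push_cast
        ring) ht
    beta_reduce at h
    rw [h]
    refine mul_pos ?_ he
    nlinarith [h0.2]
  have hanti : AntitoneOn (fun t => γ t 2) (Ici 0) := by
    refine antitoneOn_of_hasDerivWithinAt_nonpos (convex_Ici 0) (by fun_prop)
      (fun t ht => (hderiv t (interior_subset ht)).mono interior_subset) fun t ht => ?_
    have ht' : 0 ≤ t := interior_subset ht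
    have h1 := hsph t ht'
    have h2 := hbarrier t ht'
    have h3 := hnonneg t ht'
    refine mul_nonpos_of_nonpos_of_nonneg (neg_nonpos.2 ?_) h3
    refine mul_nonneg (by positivity) (mul_nonneg (mul_nonneg (pow_nonneg h3 _) ?_) ?_) <;>
      nlinarith
  have hle : ∀ t, 0 ≤ t → γ t 2 ≤ 1 / 10 := fun t ht =>
    (hanti self_mem_Ici ht ht).trans hz.le
  refine ⟨fun t ht => ⟨⟨hsph t ht, hnonneg t ht⟩, hle t ht⟩, ?_⟩
  -- For N > 2 the factor Z^(N - 2) makes the decay rate vanish at the equator, so there is no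
  -- uniform exponential bound. But if Z stayed above ε, the rate would be at least ε^(N - 2)/2 and
  -- would force Z → 0.
  have hsmall : ∀ ε : ℝ, 0 < ε → ∃ t, 0 ≤ t ∧ γ t 2 < ε := by
    intro ε hε
    by_contra! hcon
    have hlim : Tendsto (fun t => γ t 2) atTop (𝓝 0) :=
      tendsto_zero_of_hasDerivWithinAt (by fun_prop) hderiv
        (c := ε ^ (W.totalDegree - 2) * (1 / 2)) (by positivity) fun t ht => by
          have h1 := half_le_radial_factor (r := γ t 0 ^ 2 + γ t 1 ^ 2) (hsph t ht)
            (z := γ t 2) (by nlinarith [hnonneg t ht, hle t ht])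
          have h2 : ε ^ (W.totalDegree - 2) ≤ γ t 2 ^ (W.totalDegree - 2) :=
            pow_le_pow_left₀ hε.le (hcon t ht) _
          have h3 := mul_le_mul h2 h1 (by norm_num) (pow_nonneg (hnonneg t ht) _)
          unfold sphereRadialRate
          linarith
    have := ge_of_tendsto hlim ((eventually_ge_atTop 0).mono hcon)
    linarith
  refine Metric.tendsto_atTop.2 fun ε hε => ?_
  obtain ⟨t₀, ht₀, h⟩ := hsmall ε hε
  refine ⟨t₀, fun t ht => ?_⟩
  have ht' : 0 ≤ t := ht₀.trans ht
  rw [Real.dist_eq, sub_zero, abs_of_nonneg (hnonneg t ht')]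
  exact (hanti ht₀ ht' ht).trans_lt h

theorem isAttractingLimitCycle_equator (hW : IsAdmissibleFactor W) :
    IsAttractingLimitCycle (modifiedP4 W).poincareField upperHemisphere equator := by
  refine ⟨equator_subset_upperHemisphere, isCycle_equator hW, {u | u 2 < 1 / 10},
    isOpen_lt (by fun_prop) (by fun_prop), fun u hu => ?_, fun p hp => ⟨?_, ?_⟩⟩
  · show u 2 < 1 / 10
    rw [hu.2]
    norm_num
  · obtain ⟨γ, h0, hγ, -⟩ := exists_isIntegralCurve_of_trapped
      (modifiedP4 W).contDiff_poincareField (p := p) isBounded_sphere fun φ γ hφ h0 hγ t =>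
        sphere_invariant hW convex_univ (mem_univ _) hφ hγ.continuous (hγ.isIntegralCurveOn univ)
          (h0 ▸ hp.2.1) (mem_univ t)
    exact ⟨γ, h0, hγ.isIntegralCurveOn _⟩
  refine fun γ => omegaLimitSet_eq_of_forall_continuous fun γ hγc h0 hγ => ?_
  obtain ⟨hnear, hlim⟩ := height_bounds hW hγc hγ (h0 ▸ hp.2) (h0 ▸ hp.1)
  have hlim1 : Tendsto (fun t => γ t 0 ^ 2 + γ t 1 ^ 2) atTop (𝓝 1) := by
    have h1 : Tendsto (fun t => 1 - γ t 2 ^ 2) atTop (𝓝 (1 - 0 ^ 2)) := (hlim.pow 2).const_sub 1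
    rw [zero_pow two_ne_zero, sub_zero] at h1
    refine h1.congr' ?_
    filter_upwards [eventually_ge_atTop 0] with t ht
    linarith [(hnear t ht).1.1]
  ext q
  refine ⟨fun hq => ?_, fun hq => ?_⟩
  · have hq' : MapClusterPt q atTop γ := hq
    have h1 := hq'.continuousAt_comp (f := fun p => p 0 ^ 2 + p 1 ^ 2) (by fun_prop)
    have h2 := hq'.continuousAt_comp (f := fun p => p 2) (continuous_apply 2).continuousAt
    exact ⟨eq_of_nhds_neBot (h1.clusterPt.mono hlim1).neBot,
      eq_of_nhds_neBot (h2.clusterPt.mono hlim).neBot⟩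
  · choose t ht htγ using fun n : ℕ => exists_ge_eq_sqrt_mul_of_near_equator hW hγc hγ hnear hq n
    have htop : Tendsto t atTop atTop := tendsto_atTop_mono ht tendsto_natCast_atTop_atTop
    refine MapClusterPt.of_comp htop (Tendsto.mapClusterPt ?_)
    have hr : Tendsto (fun n => √(γ (t n) 0 ^ 2 + γ (t n) 1 ^ 2)) atTop (𝓝 1) := by
      simpa [Function.comp_def] using (Real.continuous_sqrt.tendsto 1).comp (hlim1.comp htop)
    refine tendsto_pi_nhds.2 fun i => ?_
    fin_cases i
    · refine Tendsto.congr (fun n => (congrFun (htγ n) 0).symm) ?_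
      simpa using hr.mul_const (q 0)
    · refine Tendsto.congr (fun n => (congrFun (htγ n) 1).symm) ?_
      simpa using hr.mul_const (q 1)
    · show Tendsto _ _ (𝓝 (q 2))
      rw [hq.2]
      exact hlim.comp htop

end Equator

/-! ### Assembly and the example R4 -/

theorem hasP4PhasePortrait_modifiedP4 {W : MvPolynomial (Fin 2) ℝ} (hW : IsAdmissibleFactor W) :
    HasP4PhasePortrait (modifiedP4 W) where
  fixedPoints := fixedPoints_modifiedP4 hW.1
  spiral_O := isUnstableSpiral_pointO hW.1
  node_A := isUnstableNode_pointA hW.1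
  saddle_B := isSaddle_pointB hW.1
  limitCycle := isAttractingLimitCycle_circle hW.1
  cycle_unique := fun _ hΓ => cycle_eq_circle hW.1 hΓ
  heteroclinic_left := by
    convert isHeteroclinicOrbit_arc hW.1 (σ := -1) (Or.inr rfl) using 1
    ext p
    refine and_congr_right fun _ => ?_
    constructor <;> intro h <;> linarith
  heteroclinic_right := by
    convert isHeteroclinicOrbit_arc hW.1 (σ := 1) (Or.inl rfl) using 1
    ext p
    refine and_congr_right fun _ => ?_
    constructor <;> intro h <;> linarith
  limitCycle_infinity := isAttractingLimitCycle_equator hW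

theorem isAdmissibleFactor_sq_add_sq_add_one :
    IsAdmissibleFactor (MvPolynomial.X 0 ^ 2 + MvPolynomial.X 1 ^ 2 + 1) := by
  have hdeg : (X 0 ^ 2 + X 1 ^ 2 + 1 : MvPolynomial (Fin 2) ℝ).totalDegree = 2 := by
    rw [totalDegree_add_eq_left_of_totalDegree_lt, totalDegree_sq_add_sq]
    rw [totalDegree_sq_add_sq, totalDegree_one]
    norm_num
  refine ⟨fun p => ?_, hdeg.ge, fun p hp => ?_⟩
  · simp
    positivity
  · rw [hdeg, map_add, homogeneousComponent_eq_self isHomogeneous_sq_add_sq,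
      homogeneousComponent_eq_zero 2 1 (by simp), add_zero]
    simp
    by_contra hcon
    refine hp (funext fun i => ?_)
    fin_cases i
    · show p 0 = 0
      nlinarith [sq_nonneg (p 0), sq_nonneg (p 1)]
    · show p 1 = 0
      nlinarith [sq_nonneg (p 0), sq_nonneg (p 1)]

theorem theorem3 :
    (∀ W : MvPolynomial (Fin 2) ℝ, IsAdmissibleFactor W → HasP4PhasePortrait (modifiedP4 W)) ∧
    (IsAdmissibleFactor (MvPolynomial.X 0 ^ 2 + MvPolynomial.X 1 ^ 2 + 1) ∧
      modifiedP4 (MvPolynomial.X 0 ^ 2 + MvPolynomial.X 1 ^ 2 + 1) = systemR4 ∧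
      HasP4PhasePortrait systemR4) :=
  ⟨fun _ => hasP4PhasePortrait_modifiedP4, isAdmissibleFactor_sq_add_sq_add_one, rfl,
    hasP4PhasePortrait_modifiedP4 isAdmissibleFactor_sq_add_sq_add_one⟩
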